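/- Let $r\ge 3$ be an integer. The random $r$-generalized triadic process on the vertex set $[n]$ is defined as follows. Let $H=\mathbb{H}_r(n,p)$ be the random $r$-uniform hypergraph on $[n]$ in which each $r$-set is a hyperedge independently with probability $p$. Start with the complete bipartite graph $G_0=K_{r-2,\,n-r+2}$ on $[n]$. In each step $t=0,1,2,\dots$ choose two distinct vertices $x,y$ uniformly at random (independently of $H$ and of the earlier choices); if there is a set $Z\subseteq[n]$ with $|Z|=r-2$ such that $xz$ and $yz$ are edges of $G_t$ for all $z\in Z$ and $\{x,y\}\cup Z$ is a hyperedge of $H$, let $G_{t+1}=G_t\cup\{xy\}$; otherwise let $G_{t+1}=G_t$. The final number of added edges is the number of edges of $\bigcup_t G_t$ that are not edges of $G_0$. **Theorem 1.1.** Let $r\ge 3$ be a fixed integer, let $\alpha>\tfrac12$ be a constant, and let $p=p(n)\in[0,1]$ satisfy $p=o\big(n^{-1/2}(\log n)^{\alpha(3-r)}\big)$ and $p=\omega(n^{-2})$ as $n\to\infty$. Then, with high probability, the final number $N_n$ of added edges in the random $r$-generalized triadic process equals $(1\pm o(1))\,\tfrac12 n^2p$; that is, for every $\varepsilon>0$,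 $$\lim_{n\to\infty}\mathbb{P}\Big[\,\big|N_n-\tfrac12 n^2p\big|\le \varepsilon\,\tfrac12 n^2p\,\Big]=1 .$$ -/

import Mathlib

open MeasureTheory ProbabilityTheory Filter Asymptotics
open scoped Topology

namespace Triadic

/-- The complete bipartite graph `K_{r-2, n-r+2}` on `Fin n`: the part of size `r - 2` consists of
the first `r - 2` vertices `v_1, …, v_{r-2}`. -/
def startGraph (r n : ℕ) : SimpleGraph (Fin n) where
  Adj x y := ¬ ((x : ℕ) < r - 2 ↔ (y : ℕ) < r - 2)
  symm := ⟨fun _ _ h h' => h h'.symm⟩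
  loopless := ⟨fun _ h => h Iff.rfl⟩

/-- In the current graph `G`, with hyperedge set `H`, the pair `x, y` may be added: there is a set
`Z` of `r - 2` common neighbours of `x` and `y` such that `{x, y} ∪ Z` is a hyperedge. -/
def CanAdd {n : ℕ} (r : ℕ) (H : Set (Finset (Fin n))) (G : SimpleGraph (Fin n))
    (x y : Fin n) : Prop :=
  ∃ Z : Finset (Fin n), Z.card = r - 2 ∧ (∀ z ∈ Z, G.Adj x z ∧ G.Adj y z) ∧
    insert x (insert y Z) ∈ H

open Classical in
/-- One step of the process, in which the pair `q` has been chosen. -/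
noncomputable def step {n : ℕ} (r : ℕ) (H : Set (Finset (Fin n))) (G : SimpleGraph (Fin n))
    (q : Fin n × Fin n) : SimpleGraph (Fin n) :=
  if CanAdd r H G q.1 q.2 then G ⊔ SimpleGraph.edge q.1 q.2 else G

/-- The graph after `t` steps, where `c s` is the pair chosen in step `s`. -/
noncomputable def process {n : ℕ} (r : ℕ) (H : Set (Finset (Fin n)))
    (c : ℕ → Fin n × Fin n) : ℕ → SimpleGraph (Fin n)
  | 0 => startGraph r n
  | t + 1 => step r H (process r H c t) (c t)

/-- The final graph of the process: all edges that are present at some time (edges are never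
removed, so this is the graph at which the process becomes constant). -/
noncomputable def finalGraph {n : ℕ} (r : ℕ) (H : Set (Finset (Fin n)))
    (c : ℕ → Fin n × Fin n) : SimpleGraph (Fin n) :=
  ⨆ t, process r H c t

/-- The final number of added edges. -/
noncomputable def addedEdges {n : ℕ} (r : ℕ) (H : Set (Finset (Fin n)))
    (c : ℕ → Fin n × Fin n) : ℕ :=
  ((finalGraph r H c).edgeSet \ (startGraph r n).edgeSet).ncard

/-- The law of the random `r`-uniform hypergraph `H_r(n, p)` on `Fin n`: every `r`-set is a
hyperedge independently with probability `p`. -/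
noncomputable def randomHypergraph (r n : ℕ) (p : unitInterval) :
    Measure (Set (Finset (Fin n))) :=
  setBernoulli {e : Finset (Fin n) | e.card = r} p

/-- The law of the sequence of chosen pairs: independent uniformly random pairs of two distinct
vertices. (It is a probability measure whenever there are two distinct vertices, `2 ≤ n`.) -/
noncomputable def randomChoices (n : ℕ) : Measure (ℕ → Fin n × Fin n) :=
  Measure.infinitePi fun _ => uniformOn {q : Fin n × Fin n | q.1 ≠ q.2}

/-- The probability space of the random `r`-generalized triadic process: the random hypergraph and,
independently of it, the sequence of chosen pairs. -/
noncomputable def triadicMeasure (r n : ℕ) (p : unitInterval) :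
    Measure (Set (Finset (Fin n)) × (ℕ → Fin n × Fin n)) :=
  (randomHypergraph r n p).prod (randomChoices n)

end Triadic

/-! Let `C` be the part of size `r - 2`. A hyperedge `C ∪ {x, y}` (a base hyperedge) allows `xy`
from the start, since `C` consists of common neighbours of `x` and `y`. Almost surely every pair is
chosen eventually, so all these pairs are added (`card_le_addedEdges`). Their number is binomial
with mean asymptotic to `n²p/2`, which tends to infinity, so Chebyshev's inequality gives the lower
bound.

For the upper bound, the process is dominated by a closure that does not depend on the order of
choices: vertices of `C` count as adjacent to everything, and once a hyperedge contains an eligible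
pair, all its vertices outside `C` become pairwise adjacent (`process_adj_outer`). The closure is
explored by testing eligible `r`-sets one at a time, each test being a fresh coin of bias `p`. The
exploration stops if some degree exceeds `Δ` or some codegree exceeds `D`, where `D` is about `(log
n)^(2α)` and `Δ` about `D + 8rnp`. While these bounds hold, few eligible sets can affect a given
degree or codegree, and an exponential supermartingale (`bernSum_exp_tail`) bounds each failure
probability by `exp(-(log n)^(2α) / (2r))`. This beats the union bound over `n²` pairs because `2α >
1`.

It remains to see that hyperedges with three or more vertices outside `C` are rare. Such an eligible
set contains an edge of the explored graph, so there are at most `T = r²(Δ + r)K` of them per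
hyperedge found, where `K = completions r D`. If `x` and `b` are the expected numbers of such
hyperedges found and of base hyperedges, then `x ≤ pT(x + b)` (`bernSum_large_le`). The upper bound
on `p` makes `pT` tend to `0` (`tendsto_degBound_mul_completions`), so `x = o(b)`, and each of these
hyperedges accounts for at most `r²` added edges. -/

namespace Triadic

/-! ### Random subsets of a finite set: mean and variance of counts. -/

section Bernoulli

variable {ι : Type*} [DecidableEq ι]

/-- The expectation of `f A`, where `A` is the random subset of `U` that contains each element
independently with probability `p`. -/
noncomputable def bernSum (p : ℝ) (U : Finset ι) (f : Finset ι → ℝ) : ℝ :=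
  ∑ A ∈ U.powerset, p ^ A.card * (1 - p) ^ (U \ A).card * f A

theorem bernSum_empty (p : ℝ) (f : Finset ι → ℝ) : bernSum p ∅ f = f ∅ := by
  simp [bernSum]

theorem bernSum_insert (p : ℝ) {U : Finset ι} {i : ι} (hi : i ∉ U) (f : Finset ι → ℝ) :
    bernSum p (insert i U) f =
      (1 - p) * bernSum p U f + p * bernSum p U (fun A => f (insert i A)) := by
  unfold bernSum
  rw [Finset.sum_powerset_insert hi, Finset.mul_sum, Finset.mul_sum]
  congr 1
  · refine Finset.sum_congr rfl fun A hA => ?_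
    have hA' : i ∉ A := fun h => hi (Finset.mem_powerset.1 hA h)
    rw [Finset.insert_sdiff_of_notMem _ hA', Finset.card_insert_of_notMem (by simp [hi])]
    ring
  · refine Finset.sum_congr rfl fun A hA => ?_
    have hA' : i ∉ A := fun h => hi (Finset.mem_powerset.1 hA h)
    have h : insert i U \ insert i A = U \ A := by
      ext j
      simp only [Finset.mem_sdiff, Finset.mem_insert]
      constructor
      · rintro ⟨h1 | h1, h2⟩ <;> tauto
      · rintro ⟨h1, h2⟩
        refine ⟨Or.inr h1, ?_⟩
        rintro (rfl | h3)
        · exact hi h1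
        · exact h2 h3
    rw [h, Finset.card_insert_of_notMem hA']
    ring

theorem bernSum_congr (p : ℝ) {U : Finset ι} {f g : Finset ι → ℝ} (h : ∀ A ⊆ U, f A = g A) :
    bernSum p U f = bernSum p U g :=
  Finset.sum_congr rfl fun A hA => by rw [h A (Finset.mem_powerset.1 hA)]

theorem bernSum_mono {p : ℝ} (h0 : 0 ≤ p) (h1 : p ≤ 1) {U : Finset ι} {f g : Finset ι → ℝ}
    (h : ∀ A ⊆ U, f A ≤ g A) : bernSum p U f ≤ bernSum p U g :=
  Finset.sum_le_sum fun A hA => mul_le_mul_of_nonneg_left (h A (Finset.mem_powerset.1 hA))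
    (mul_nonneg (pow_nonneg h0 _) (pow_nonneg (by linarith) _))

theorem bernSum_add (p : ℝ) (U : Finset ι) (f g : Finset ι → ℝ) :
    bernSum p U (fun A => f A + g A) = bernSum p U f + bernSum p U g := by
  simp [bernSum, mul_add, Finset.sum_add_distrib]

theorem bernSum_const_mul (p a : ℝ) (U : Finset ι) (f : Finset ι → ℝ) :
    bernSum p U (fun A => a * f A) = a * bernSum p U f := by
  simp only [bernSum, Finset.mul_sum]
  exact Finset.sum_congr rfl fun A _ => by ring

theorem bernSum_sum {κ : Type*} (p : ℝ) (U : Finset ι) (s : Finset κ) (f : κ → Finset ι → ℝ) :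
    bernSum p U (fun A => ∑ k ∈ s, f k A) = ∑ k ∈ s, bernSum p U (f k) := by
  simp only [bernSum, Finset.mul_sum]
  exact Finset.sum_comm

theorem bernSum_const (p a : ℝ) (U : Finset ι) : bernSum p U (fun _ => a) = a := by
  induction U using Finset.induction_on with
  | empty => simp [bernSum_empty]
  | insert i U hi ih => rw [bernSum_insert p hi, ih]; ring

theorem bernSum_card_inter (p : ℝ) (U B : Finset ι) :
    bernSum p U (fun A => ((A ∩ B).card : ℝ)) = p * (U ∩ B).card := by
  induction U using Finset.induction_on with
  | empty => simp [bernSum_empty]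
  | insert i U hi ih =>
    rw [bernSum_insert p hi, ih]
    by_cases hB : i ∈ B
    · have : bernSum p U (fun A => ((insert i A ∩ B).card : ℝ)) =
          bernSum p U (fun A => ((A ∩ B).card : ℝ) + 1) := by
        refine bernSum_congr p fun A hA => ?_
        rw [Finset.insert_inter_of_mem hB, Finset.card_insert_of_notMem]
        · push_cast; ring
        · exact fun h => hi (hA (Finset.mem_inter.1 h).1)
      rw [this, bernSum_add, ih, bernSum_const, Finset.insert_inter_of_mem hB,
        Finset.card_insert_of_notMem (fun h => hi (Finset.mem_inter.1 h).1)]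
      push_cast; ring
    · have : bernSum p U (fun A => ((insert i A ∩ B).card : ℝ)) =
          bernSum p U (fun A => ((A ∩ B).card : ℝ)) := by
        refine bernSum_congr p fun A hA => ?_
        rw [Finset.insert_inter_of_notMem hB]
      rw [this, ih, Finset.insert_inter_of_notMem hB]
      ring

theorem bernSum_variance (p : ℝ) (U B : Finset ι) :
    bernSum p U (fun A => (((A ∩ B).card : ℝ) - p * (U ∩ B).card) ^ 2) =
      p * (1 - p) * (U ∩ B).card := by
  induction U using Finset.induction_on with
  | empty => simp [bernSum_empty]
  | insert i U hi ih =>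
    rw [bernSum_insert p hi]
    by_cases hB : i ∈ B
    · have hc : ((insert i U ∩ B).card : ℝ) = (U ∩ B).card + 1 := by
        rw [Finset.insert_inter_of_mem hB,
          Finset.card_insert_of_notMem (fun h => hi (Finset.mem_inter.1 h).1)]
        push_cast; ring
      -- The centred count has mean zero, so the cross terms with the new element vanish in both
      -- `e1` and `e2`.
      have hlin : bernSum p U (fun A => ((A ∩ B).card : ℝ) + -(p * (U ∩ B).card)) = 0 := by
        rw [bernSum_add, bernSum_card_inter, bernSum_const]; ring
      have e1 : bernSum p U (fun A => (((A ∩ B).card : ℝ) - p * (insert i U ∩ B).card) ^ 2) =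
          bernSum p U (fun A => (((A ∩ B).card : ℝ) - p * (U ∩ B).card) ^ 2) + p ^ 2 := by
        rw [← bernSum_const p (p ^ 2) U, ← bernSum_add]
        have : bernSum p U (fun A => (((A ∩ B).card : ℝ) - p * (insert i U ∩ B).card) ^ 2) =
          bernSum p U (fun A => ((((A ∩ B).card : ℝ) - p * (U ∩ B).card) ^ 2 + p ^ 2) +
            (-2 * p) * (((A ∩ B).card : ℝ) + -(p * (U ∩ B).card))) :=
          bernSum_congr p fun A _ => by rw [hc]; ring
        rw [this, bernSum_add, bernSum_const_mul, hlin]; ring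
      have e2 : bernSum p U
          (fun A => (((insert i A ∩ B).card : ℝ) - p * (insert i U ∩ B).card) ^ 2) =
          bernSum p U (fun A => (((A ∩ B).card : ℝ) - p * (U ∩ B).card) ^ 2) + (1 - p) ^ 2 := by
        rw [← bernSum_const p ((1 - p) ^ 2) U, ← bernSum_add]
        have : bernSum p U
            (fun A => (((insert i A ∩ B).card : ℝ) - p * (insert i U ∩ B).card) ^ 2) =
          bernSum p U (fun A => ((((A ∩ B).card : ℝ) - p * (U ∩ B).card) ^ 2 + (1 - p) ^ 2) +
            (2 * (1 - p)) * (((A ∩ B).card : ℝ) + -(p * (U ∩ B).card))) := by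
          refine bernSum_congr p fun A hA => ?_
          have : ((insert i A ∩ B).card : ℝ) = (A ∩ B).card + 1 := by
            rw [Finset.insert_inter_of_mem hB,
              Finset.card_insert_of_notMem (fun h => hi (hA (Finset.mem_inter.1 h).1))]
            push_cast; ring
          rw [hc, this]; ring
        rw [this, bernSum_add, bernSum_const_mul, hlin]; ring
      rw [e1, e2, ih, hc]; ring
    · have : bernSum p U
          (fun A => (((insert i A ∩ B).card : ℝ) - p * (insert i U ∩ B).card) ^ 2) =
          bernSum p U (fun A => (((A ∩ B).card : ℝ) - p * (U ∩ B).card) ^ 2) := by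
        refine bernSum_congr p fun A hA => ?_
        rw [Finset.insert_inter_of_notMem hB, Finset.insert_inter_of_notMem hB]
      rw [this, Finset.insert_inter_of_notMem hB, ih]
      ring

/-! ### Adaptive exploration of a random set. -/

/-- One step of an adaptive exploration of the random set `A`: the state consists of the set of
tested elements and of the set of those found in `A`; `next` selects the element to be tested. -/
def exploreStep (next : Finset ι → Finset ι → Option ι) (A : Finset ι)
    (s : Finset ι × Finset ι) : Finset ι × Finset ι :=
  match next s.1 s.2 with
  | none => s
  | some i => (insert i s.1, if i ∈ A then insert i s.2 else s.2)

/-- The state of the exploration after `k` steps from the state `s`. -/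
def explore (next : Finset ι → Finset ι → Option ι) (A : Finset ι) :
    ℕ → Finset ι × Finset ι → Finset ι × Finset ι
  | 0, s => s
  | k + 1, s => explore next A k (exploreStep next A s)

/-- Optional stopping for a supermartingale `Φ`. Given the state `(R, Y)`, the part of the random
set in `U \ R` is still unbiased, so the hidden set is written `Y ∪ A` with `A` random in `U \ R`.
Conditioning on the tested element `i` alone yields exactly the two states averaged in `hΦ`. -/
theorem bernSum_explore_le {p : ℝ} (h0 : 0 ≤ p) (h1 : p ≤ 1) {U : Finset ι}
    {next : Finset ι → Finset ι → Option ι}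
    (hnext : ∀ R Y i, next R Y = some i → i ∈ U \ R)
    (Φ : Finset ι × Finset ι → ℝ)
    (hΦ : ∀ R Y i, Y ⊆ R → next R Y = some i →
      (1 - p) * Φ (insert i R, Y) + p * Φ (insert i R, insert i Y) ≤ Φ (R, Y)) (k : ℕ) :
    ∀ R Y : Finset ι, Y ⊆ R →
      bernSum p (U \ R) (fun A => Φ (explore next (Y ∪ A) k (R, Y))) ≤ Φ (R, Y) := by
  induction k with
  | zero =>
    intro R Y _
    simp only [explore]
    rw [bernSum_const]
  | succ k ih =>
    intro R Y hYR
    rcases hi : next R Y with _ | i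
    · have : ∀ A, explore next (Y ∪ A) (k + 1) (R, Y) = explore next (Y ∪ A) k (R, Y) := by
        intro A
        simp [explore, exploreStep, hi]
      simp only [this]
      exact ih R Y hYR
    · have hiU := hnext R Y i hi
      obtain ⟨hiU1, hiR⟩ := Finset.mem_sdiff.1 hiU
      have hU : U \ R = insert i (U \ insert i R) := by
        ext j
        simp only [Finset.mem_sdiff, Finset.mem_insert]
        by_cases hj : j = i
        · subst hj; simp [hiU1, hiR]
        · simp [hj]
      have hiU' : i ∉ U \ insert i R := by simp
      rw [hU, bernSum_insert p hiU']
      have e1 : bernSum p (U \ insert i R) (fun A => Φ (explore next (Y ∪ A) (k + 1) (R, Y))) =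
          bernSum p (U \ insert i R) (fun A => Φ (explore next (Y ∪ A) k (insert i R, Y))) := by
        refine bernSum_congr p fun A hA => ?_
        have : i ∉ Y ∪ A := by
          rw [Finset.mem_union]
          rintro (h | h)
          · exact hiR (hYR h)
          · exact hiU' (hA h)
        simp only [explore, exploreStep, hi, this, if_false]
      have e2 : bernSum p (U \ insert i R)
            (fun A => Φ (explore next (Y ∪ insert i A) (k + 1) (R, Y))) =
          bernSum p (U \ insert i R)
            (fun A => Φ (explore next (insert i Y ∪ A) k (insert i R, insert i Y))) := by
        refine bernSum_congr p fun A hA => ?_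
        have h2 : Y ∪ insert i A = insert i Y ∪ A := by
          rw [Finset.union_insert, Finset.insert_union]
        simp only [explore, exploreStep, hi, h2, Finset.mem_union, Finset.mem_insert, true_or,
          if_true]
      rw [e1, e2]
      have i1 := ih (insert i R) Y (hYR.trans (Finset.subset_insert _ _))
      have i2 := ih (insert i R) (insert i Y) (Finset.insert_subset_insert _ hYR)
      calc _ ≤ (1 - p) * Φ (insert i R, Y) + p * Φ (insert i R, insert i Y) :=
            add_le_add (mul_le_mul_of_nonneg_left i1 (by linarith))
              (mul_le_mul_of_nonneg_left i2 h0)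
        _ ≤ _ := hΦ R Y i hYR hi

/-- The final state of the exploration of `A ⊆ U`. -/
def exploreFinal (next : Finset ι → Finset ι → Option ι) (U A : Finset ι) :
    Finset ι × Finset ι :=
  -- Each test concerns a new element of `U`, so more than `U.card` steps guarantee that the
  -- exploration has stopped.
  explore next A (U.card + 1) (∅, ∅)

theorem bernSum_exploreFinal_le {p : ℝ} (h0 : 0 ≤ p) (h1 : p ≤ 1) {U : Finset ι}
    {next : Finset ι → Finset ι → Option ι}
    (hnext : ∀ R Y i, next R Y = some i → i ∈ U \ R)
    (Φ : Finset ι × Finset ι → ℝ)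
    (hΦ : ∀ R Y i, Y ⊆ R → next R Y = some i →
      (1 - p) * Φ (insert i R, Y) + p * Φ (insert i R, insert i Y) ≤ Φ (R, Y)) :
    bernSum p U (fun A => Φ (exploreFinal next U A)) ≤ Φ (∅, ∅) := by
  simpa [exploreFinal] using bernSum_explore_le h0 h1 hnext Φ hΦ (U.card + 1) ∅ ∅ (by simp)

theorem explore_induction {next : Finset ι → Finset ι → Option ι} {A : Finset ι}
    (P : Finset ι → Finset ι → Prop)
    (hstep : ∀ R Y i, P R Y → next R Y = some i →
      P (insert i R) (if i ∈ A then insert i Y else Y)) (k : ℕ) :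
    ∀ s : Finset ι × Finset ι, P s.1 s.2 →
      P (explore next A k s).1 (explore next A k s).2 := by
  induction k with
  | zero => intro s hs; exact hs
  | succ k ih =>
    intro s hs
    refine ih _ ?_
    rcases hi : next s.1 s.2 with _ | i
    · simpa [exploreStep, hi] using hs
    · simpa [exploreStep, hi] using hstep _ _ i hs hi

theorem explore_stops {U : Finset ι} {next : Finset ι → Finset ι → Option ι} {A : Finset ι}
    (hnext : ∀ R Y i, next R Y = some i → i ∈ U \ R) (k : ℕ) :
    ∀ s : Finset ι × Finset ι, s.1 ⊆ U → U.card < s.1.card + k →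
      next (explore next A k s).1 (explore next A k s).2 = none := by
  induction k with
  | zero =>
    intro s hs hk
    exact absurd (Finset.card_le_card hs) (by omega)
  | succ k ih =>
    intro s hs hk
    rcases hi : next s.1 s.2 with _ | i
    · have : ∀ j, explore next A j s = s := by
        intro j
        induction j with
        | zero => rfl
        | succ j ihj =>
          have : exploreStep next A s = s := by simp [exploreStep, hi]
          rw [explore, this, ihj]
      rw [this, hi]
    · have h := Finset.mem_sdiff.1 (hnext _ _ _ hi)
      refine ih _ ?_ ?_
      · simpa [exploreStep, hi] using Finset.insert_subset h.1 hs
      · simp only [exploreStep, hi, Finset.card_insert_of_notMem h.2]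
        omega

theorem exploreFinal_stops {U : Finset ι} {next : Finset ι → Finset ι → Option ι}
    (A : Finset ι) (hnext : ∀ R Y i, next R Y = some i → i ∈ U \ R) :
    next (exploreFinal next U A).1 (exploreFinal next U A).2 = none :=
  explore_stops hnext _ _ (by simp) (by simp)

theorem exploreFinal_induction {U : Finset ι} {next : Finset ι → Finset ι → Option ι}
    {A : Finset ι} (P : Finset ι → Finset ι → Prop) (h0 : P ∅ ∅)
    (hstep : ∀ R Y i, P R Y → next R Y = some i →
      P (insert i R) (if i ∈ A then insert i Y else Y)) :
    P (exploreFinal next U A).1 (exploreFinal next U A).2 :=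
  explore_induction P hstep _ _ h0

end Bernoulli

/-! ### Deterministic counting of eligible sets under degree and codegree bounds. -/

section Counting

open scoped Classical

set_option linter.unusedSectionVars false

variable {V : Type*} [Fintype V] [DecidableEq V]

/-- The neighbours of `v`. -/
noncomputable def nb (G : SimpleGraph V) (v : V) : Finset V := {w | G.Adj v w}

theorem mem_nb {G : SimpleGraph V} {v w : V} : w ∈ nb G v ↔ G.Adj v w := by simp [nb]

/-- All degrees are at most `Δ` and all codegrees at most `D`. -/
def DegBounded (Δ D : ℕ) (G : SimpleGraph V) : Prop :=
  (∀ v, (nb G v).card ≤ Δ) ∧ ∀ u v, u ≠ v → (nb G u ∩ nb G v).card ≤ D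

/-- Outside `C`, all vertices of `S` other than `x, y` are common neighbours of `x, y`. -/
structure EligPair (C : Finset V) (G : SimpleGraph V) (S : Finset V) (x y : V) : Prop where
  left_mem : x ∈ S
  right_mem : y ∈ S
  ne : x ≠ y
  left_notMem : x ∉ C
  right_notMem : y ∉ C
  adj : ∀ z ∈ S, z ∉ C → z ≠ x → z ≠ y → G.Adj z x ∧ G.Adj z y

theorem EligPair.symm {C : Finset V} {G : SimpleGraph V} {S : Finset V} {x y : V}
    (h : EligPair C G S x y) : EligPair C G S y x :=
  ⟨h.right_mem, h.left_mem, h.ne.symm, h.right_notMem, h.left_notMem,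
    fun z hz hC h1 h2 => (h.adj z hz hC h2 h1).symm⟩

/-- Some pair of vertices of `S` is eligible to be added on account of `S`, where the vertices of
`C` are regarded as adjacent to all others. -/
def Eligible (C : Finset V) (G : SimpleGraph V) (S : Finset V) : Prop :=
  ∃ x y, EligPair C G S x y

theorem Eligible.mono {C : Finset V} {G G' : SimpleGraph V} (hG : G ≤ G') {S : Finset V}
    (h : Eligible C G S) : Eligible C G' S := by
  obtain ⟨x, y, h⟩ := h
  exact ⟨x, y, h.left_mem, h.right_mem, h.ne, h.left_notMem, h.right_notMem,
    fun z hz hC h1 h2 => ⟨hG (h.adj z hz hC h1 h2).1, hG (h.adj z hz hC h1 h2).2⟩⟩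

/-- The sets that consist of `x, z, y` and of further `#C - 1` vertices, each of them in `C` or a
common neighbour of `x, y`. -/
noncomputable def starSets (C : Finset V) (G : SimpleGraph V) (x z y : V) : Finset (Finset V) :=
  ((C ∪ (nb G x ∩ nb G y)).powersetCard (C.card - 1)).image
    fun Q => insert x (insert y (insert z Q))

/-- The sets that consist of `x, z, w, y` and of further `#C - 2` vertices, each of them in `C` or a
common neighbour of `x, y`. -/
noncomputable def doubleStarSets (C : Finset V) (G : SimpleGraph V) (x z w y : V) :
    Finset (Finset V) :=
  if 2 ≤ C.card then ((C ∪ (nb G x ∩ nb G y)).powersetCard (C.card - 2)).image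
    fun Q => insert x (insert y (insert z (insert w Q))) else ∅

theorem card_starSets_le {C : Finset V} {Δ D : ℕ} {G : SimpleGraph V} (hG : DegBounded Δ D G)
    {x y : V} (hxy : x ≠ y) (z : V) :
    (starSets C G x z y).card ≤ (C.card + D) ^ (C.card - 1) := by
  refine Finset.card_image_le.trans ?_
  rw [Finset.card_powersetCard]
  refine (Nat.choose_le_pow _ _).trans (Nat.pow_le_pow_left ?_ _)
  exact (Finset.card_union_le _ _).trans (Nat.add_le_add_left (hG.2 x y hxy) _)

/-- The factor `D` pays for a later choice of `y` among the common neighbours of `z` and `w`.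
Prescribing two centres removes one free vertex, which absorbs that choice. -/
theorem mul_card_doubleStarSets_le {C : Finset V} {Δ D : ℕ} {G : SimpleGraph V}
    (hG : DegBounded Δ D G) {x y : V} (hxy : x ≠ y) (z w : V) :
    D * (doubleStarSets C G x z w y).card ≤ (C.card + D) ^ (C.card - 1) := by
  unfold doubleStarSets
  split_ifs with h
  · have h1 : (((C ∪ (nb G x ∩ nb G y)).powersetCard (C.card - 2)).image
        fun Q => insert x (insert y (insert z (insert w Q)))).card
          ≤ (C.card + D) ^ (C.card - 2) := by
      refine Finset.card_image_le.trans ?_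
      rw [Finset.card_powersetCard]
      refine (Nat.choose_le_pow _ _).trans (Nat.pow_le_pow_left ?_ _)
      exact (Finset.card_union_le _ _).trans (Nat.add_le_add_left (hG.2 x y hxy) _)
    have h2 : C.card - 1 = (C.card - 2) + 1 := by omega
    rw [h2, pow_succ']
    exact Nat.mul_le_mul (by omega) h1
  · simp

theorem EligPair.mem_starSets {C : Finset V} {G : SimpleGraph V} {S : Finset V} {x y z : V}
    (h : EligPair C G S x y) (hS : S.card = C.card + 2) (hz : z ∈ S) (hzx : z ≠ x) (hzy : z ≠ y) :
    S ∈ starSets C G x z y := by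
  refine Finset.mem_image.2 ⟨((S.erase x).erase y).erase z, ?_, ?_⟩
  · rw [Finset.mem_powersetCard]
    constructor
    · intro q hq
      simp only [Finset.mem_erase] at hq
      by_cases hqC : q ∈ C
      · exact Finset.mem_union_left _ hqC
      · have := h.adj q hq.2.2.2 hqC hq.2.2.1 hq.2.1
        exact Finset.mem_union_right _
          (Finset.mem_inter.2 ⟨mem_nb.2 this.1.symm, mem_nb.2 this.2.symm⟩)
    · rw [Finset.card_erase_of_mem (by simp [hz, hzx, hzy]),
        Finset.card_erase_of_mem (by simp [h.right_mem, h.ne.symm]),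
        Finset.card_erase_of_mem h.left_mem]
      omega
  · ext q
    simp only [Finset.mem_insert, Finset.mem_erase]
    by_cases h1 : q = x
    · subst h1; simp [h.left_mem]
    by_cases h2 : q = y
    · subst h2; simp [h.right_mem]
    by_cases h3 : q = z
    · subst h3; simp [hz]
    simp [h1, h2, h3]

theorem EligPair.mem_doubleStarSets {C : Finset V} {G : SimpleGraph V} {S : Finset V}
    {x y z w : V} (h : EligPair C G S x y) (hS : S.card = C.card + 2)
    (hz : z ∈ S) (hzx : z ≠ x) (hzy : z ≠ y) (hw : w ∈ S) (hwx : w ≠ x)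
    (hwy : w ≠ y) (hwz : w ≠ z) : S ∈ doubleStarSets C G x z w y := by
  have hcard : ((((S.erase x).erase y).erase z).erase w).card + 4 = S.card := by
    have h1 := Finset.card_erase_add_one h.left_mem
    have h2 := Finset.card_erase_add_one (s := S.erase x) (a := y) (by simp [h.right_mem, h.ne.symm])
    have h3 := Finset.card_erase_add_one (s := (S.erase x).erase y) (a := z) (by simp [hz, hzx, hzy])
    have h4 := Finset.card_erase_add_one (s := ((S.erase x).erase y).erase z) (a := w)
      (by simp [hw, hwx, hwy, hwz])
    omega
  rw [doubleStarSets, if_pos (by omega)]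
  refine Finset.mem_image.2 ⟨(((S.erase x).erase y).erase z).erase w, ?_, ?_⟩
  · rw [Finset.mem_powersetCard]
    constructor
    · intro q hq
      simp only [Finset.mem_erase] at hq
      by_cases hqC : q ∈ C
      · exact Finset.mem_union_left _ hqC
      · have := h.adj q hq.2.2.2.2 hqC hq.2.2.2.1 hq.2.2.1
        exact Finset.mem_union_right _
          (Finset.mem_inter.2 ⟨mem_nb.2 this.1.symm, mem_nb.2 this.2.symm⟩)
    · omega
  · ext q
    simp only [Finset.mem_insert, Finset.mem_erase]
    by_cases h1 : q = x
    · subst h1; simp [h.left_mem]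
    by_cases h2 : q = y
    · subst h2; simp [h.right_mem]
    by_cases h3 : q = z
    · subst h3; simp [hz]
    by_cases h4 : q = w
    · subst h4; simp [hw]
    simp [h1, h2, h3, h4]

theorem EligPair.eq_or_exists {C : Finset V} {G : SimpleGraph V} {S : Finset V} {x y : V}
    (h : EligPair C G S x y) (hS : S.card = C.card + 2) :
    S = insert x (insert y C) ∨ ∃ z ∈ S, z ∉ C ∧ z ≠ x ∧ z ≠ y := by
  by_cases hz : ∃ z ∈ S, z ∉ C ∧ z ≠ x ∧ z ≠ y
  · exact Or.inr hz
  · left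
    push Not at hz
    refine Finset.eq_of_subset_of_card_le ?_ ?_
    · intro q hq
      simp only [Finset.mem_insert]
      by_contra hcon
      push Not at hcon
      exact hcon.2.1 (hz q hq hcon.2.2 hcon.1)
    · rw [Finset.card_insert_of_notMem (by simp [h.ne, h.left_notMem]),
        Finset.card_insert_of_notMem h.right_notMem, hS]

theorem exists_third_of_large {C S : Finset V} (hl : 3 ≤ (S \ C).card) (x y : V) :
    ∃ z ∈ S, z ∉ C ∧ z ≠ x ∧ z ≠ y := by
  by_contra hcon
  push Not at hcon
  have : S \ C ⊆ {x, y} := by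
    intro q hq
    rw [Finset.mem_sdiff] at hq
    simp only [Finset.mem_insert, Finset.mem_singleton]
    by_contra h1
    push Not at h1
    exact h1.2 (hcon q hq.1 hq.2 h1.1)
  have := (Finset.card_le_card this).trans Finset.card_le_two
  omega

theorem card_union_le_of_le {α : Type*} [DecidableEq α] {s t : Finset α} {a b : ℕ}
    (hs : s.card ≤ a) (ht : t.card ≤ b) : (s ∪ t).card ≤ a + b :=
  (Finset.card_union_le _ _).trans (add_le_add hs ht)

theorem card_biUnion_le_mul {α β : Type*} [DecidableEq β] {s : Finset α} {f : α → Finset β}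
    {a b : ℕ} (hs : s.card ≤ a) (hf : ∀ x ∈ s, (f x).card ≤ b) : (s.biUnion f).card ≤ a * b :=
  (Finset.card_biUnion_le_card_mul s f b hf).trans (Nat.mul_le_mul_right _ hs)

/-- Either `S` is `C` with `v` and one more vertex, or it contains a path of length two through `v`
outside `C`, with `v` as an endpoint or as the centre. The path has at most `Δ²` positions in each
case, and the remaining vertices lie in `C` or the common neighbourhood of its ends. -/
theorem card_eligible_mem_le {C : Finset V} {Δ D : ℕ} {G : SimpleGraph V} (hG : DegBounded Δ D G)
    {v : V} (hv : v ∉ C) (F : Finset (Finset V))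
    (hF : ∀ S ∈ F, S.card = C.card + 2 ∧ Eligible C G S ∧ v ∈ S) :
    F.card ≤ Fintype.card V + 2 * (Δ * (Δ * (C.card + D) ^ (C.card - 1))) := by
  have hcover : F ⊆ (Finset.univ.image fun w => insert v (insert w C)) ∪
      (((nb G v).biUnion fun z => ((nb G z).erase v).biUnion fun y => starSets C G v z y) ∪
      ((nb G v).biUnion fun x => ((nb G v).erase x).biUnion fun y => starSets C G x v y)) := by
    intro S hSF
    obtain ⟨hS, ⟨x, y, h⟩, hvS⟩ := hF S hSF
    have key : ∀ y, EligPair C G S v y → S ∈ (Finset.univ.image fun w => insert v (insert w C)) ∪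
      (((nb G v).biUnion fun z => ((nb G z).erase v).biUnion fun y => starSets C G v z y) ∪
      ((nb G v).biUnion fun x => ((nb G v).erase x).biUnion fun y => starSets C G x v y)) := by
      intro y h
      rcases h.eq_or_exists hS with rfl | ⟨z, hz, hzC, hzx, hzy⟩
      · exact Finset.mem_union_left _ (Finset.mem_image.2 ⟨y, Finset.mem_univ _, rfl⟩)
      · refine Finset.mem_union_right _ (Finset.mem_union_left _ ?_)
        have ha := h.adj z hz hzC hzx hzy
        exact Finset.mem_biUnion.2 ⟨z, mem_nb.2 ha.1.symm, Finset.mem_biUnion.2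
          ⟨y, Finset.mem_erase.2 ⟨h.ne.symm, mem_nb.2 ha.2⟩, h.mem_starSets hS hz hzx hzy⟩⟩
    by_cases hvx : v = x
    · subst hvx; exact key y h
    by_cases hvy : v = y
    · subst hvy; exact key x h.symm
    refine Finset.mem_union_right _ (Finset.mem_union_right _ ?_)
    have ha := h.adj v hvS hv hvx hvy
    exact Finset.mem_biUnion.2 ⟨x, mem_nb.2 ha.1, Finset.mem_biUnion.2
      ⟨y, Finset.mem_erase.2 ⟨h.ne.symm, mem_nb.2 ha.2⟩, h.mem_starSets hS hvS hvx hvy⟩⟩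
  refine (Finset.card_le_card hcover).trans ?_
  refine card_union_le_of_le (Finset.card_image_le.trans (by simp)) ?_
  rw [two_mul]
  refine card_union_le_of_le ?_ ?_
  · refine card_biUnion_le_mul (hG.1 v) fun z _ => ?_
    refine card_biUnion_le_mul ((Finset.card_erase_le).trans (hG.1 z)) fun y hy => ?_
    exact card_starSets_le hG (Finset.ne_of_mem_erase hy).symm z
  · refine card_biUnion_le_mul (hG.1 v) fun x _ => ?_
    refine card_biUnion_le_mul ((Finset.card_erase_le).trans (hG.1 v)) fun y hy => ?_
    exact card_starSets_le hG (Finset.ne_of_mem_erase hy).symm v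

/-- A third vertex `z` outside `C` is adjacent to both ends of the eligible pair. Choose the edge
`xz`, then a neighbour `y` of `z`, then the rest. -/
theorem card_large_eligible_le {C : Finset V} {Δ D : ℕ} {G : SimpleGraph V}
    (hG : DegBounded Δ D G) (F : Finset (Finset V))
    (hF : ∀ S ∈ F, S.card = C.card + 2 ∧ Eligible C G S ∧ 3 ≤ (S \ C).card)
    (E : Finset (V × V)) (hE : ∀ x y, G.Adj x y → (x, y) ∈ E) :
    F.card ≤ E.card * (Δ * (C.card + D) ^ (C.card - 1)) := by
  have hcover : F ⊆ E.biUnion fun q => ((nb G q.2).erase q.1).biUnion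
      fun y => starSets C G q.1 q.2 y := by
    intro S hSF
    obtain ⟨hS, ⟨x, y, h⟩, hl⟩ := hF S hSF
    obtain ⟨z, hz, hzC, hzx, hzy⟩ := exists_third_of_large hl x y
    have ha := h.adj z hz hzC hzx hzy
    exact Finset.mem_biUnion.2 ⟨(x, z), hE _ _ ha.1.symm, Finset.mem_biUnion.2
      ⟨y, Finset.mem_erase.2 ⟨h.ne.symm, mem_nb.2 ha.2⟩, h.mem_starSets hS hz hzx hzy⟩⟩
  refine (Finset.card_le_card hcover).trans ?_
  refine card_biUnion_le_mul le_rfl fun q _ => ?_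
  refine card_biUnion_le_mul ((Finset.card_erase_le).trans (hG.1 _)) fun y hy => ?_
  exact card_starSets_le hG (Finset.ne_of_mem_erase hy).symm _

/-- The summands correspond to the roles of `u` and `v`: both form the eligible pair (with or
without a further vertex outside `C`), exactly one belongs to it, or both are common neighbours of
it. -/
theorem card_eligible_pair_le {C : Finset V} {Δ D : ℕ} {G : SimpleGraph V}
    (hG : DegBounded Δ D G) {u v : V} (huv : u ≠ v) (hu : u ∉ C) (hv : v ∉ C)
    (F : Finset (Finset V))
    (hF : ∀ S ∈ F, S.card = C.card + 2 ∧ Eligible C G S ∧ u ∈ S ∧ v ∈ S) :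
    F.card ≤ 1 + D * (C.card + D) ^ (C.card - 1) + Δ * (C.card + D) ^ (C.card - 1)
      + Δ * (C.card + D) ^ (C.card - 1) + D * (D * (C.card + D) ^ (C.card - 1)) := by
  have hcover : F ⊆ {insert u (insert v C)} ∪
      ((nb G u ∩ nb G v).biUnion fun z => starSets C G u z v) ∪
      (((nb G v).erase u).biUnion fun y => starSets C G u v y) ∪
      (((nb G u).erase v).biUnion fun y => starSets C G v u y) ∪
      ((nb G u ∩ nb G v).biUnion fun x => ((nb G u ∩ nb G v).erase x).biUnion
        fun y => starSets C G x u y) := by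
    intro S hSF
    obtain ⟨hS, ⟨x, y, h⟩, huS, hvS⟩ := hF S hSF
    have key1 : EligPair C G S u v → S ∈ ({insert u (insert v C)} : Finset (Finset V)) ∪
        ((nb G u ∩ nb G v).biUnion fun z => starSets C G u z v) := by
      intro h
      rcases h.eq_or_exists hS with h' | ⟨z, hz, hzC, hzx, hzy⟩
      · exact Finset.mem_union_left _ (Finset.mem_singleton.2 h')
      · have ha := h.adj z hz hzC hzx hzy
        exact Finset.mem_union_right _ (Finset.mem_biUnion.2 ⟨z, Finset.mem_inter.2
          ⟨mem_nb.2 ha.1.symm, mem_nb.2 ha.2.symm⟩, h.mem_starSets hS hz hzx hzy⟩)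
    have key2 : ∀ a b y, a ≠ b → b ∉ C → b ∈ S → y ≠ b → EligPair C G S a y →
        S ∈ ((nb G b).erase a).biUnion fun y => starSets C G a b y := by
      intro a b y hab hbC hb hyb h
      have ha := h.adj b hb hbC hab.symm hyb.symm
      exact Finset.mem_biUnion.2 ⟨y, Finset.mem_erase.2 ⟨h.ne.symm, mem_nb.2 ha.2⟩,
        h.mem_starSets hS hb hab.symm hyb.symm⟩
    by_cases hxu : x = u
    · subst hxu
      by_cases hyv : y = v
      · subst hyv
        have := key1 h
        simp only [Finset.mem_union] at this ⊢
        tauto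
      · have := key2 x v y huv hv hvS hyv h
        simp only [Finset.mem_union] at this ⊢
        tauto
    by_cases hyu : y = u
    · subst hyu
      by_cases hxv : x = v
      · subst hxv
        have := key1 h.symm
        simp only [Finset.mem_union] at this ⊢
        tauto
      · have := key2 y v x huv hv hvS hxv h.symm
        simp only [Finset.mem_union] at this ⊢
        tauto
    by_cases hxv : x = v
    · subst hxv
      have := key2 x u y huv.symm hu huS hyu h
      simp only [Finset.mem_union] at this ⊢
      tauto
    by_cases hyv : y = v
    · subst hyv
      have := key2 y u x huv.symm hu huS hxu h.symm
      simp only [Finset.mem_union] at this ⊢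
      tauto
    have ha := h.adj u huS hu (Ne.symm hxu) (Ne.symm hyu)
    have hb := h.adj v hvS hv (Ne.symm hxv) (Ne.symm hyv)
    refine Finset.mem_union_right _ (Finset.mem_biUnion.2 ⟨x, Finset.mem_inter.2
      ⟨mem_nb.2 ha.1, mem_nb.2 hb.1⟩, Finset.mem_biUnion.2 ⟨y, Finset.mem_erase.2
      ⟨h.ne.symm, Finset.mem_inter.2 ⟨mem_nb.2 ha.2, mem_nb.2 hb.2⟩⟩,
        h.mem_starSets hS huS (Ne.symm hxu) (Ne.symm hyu)⟩⟩)
  refine (Finset.card_le_card hcover).trans ?_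
  refine card_union_le_of_le (card_union_le_of_le (card_union_le_of_le
    (card_union_le_of_le (by simp) ?_) ?_) ?_) ?_
  · exact card_biUnion_le_mul (hG.2 u v huv) fun z _ => card_starSets_le hG huv z
  · exact card_biUnion_le_mul ((Finset.card_erase_le).trans (hG.1 _)) fun y hy =>
      card_starSets_le hG (Finset.ne_of_mem_erase hy).symm _
  · exact card_biUnion_le_mul ((Finset.card_erase_le).trans (hG.1 _)) fun y hy =>
      card_starSets_le hG (Finset.ne_of_mem_erase hy).symm _
  · refine card_biUnion_le_mul (hG.2 u v huv) fun x _ => ?_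
    exact card_biUnion_le_mul ((Finset.card_erase_le).trans (hG.2 u v huv)) fun y hy =>
      card_starSets_le hG (Finset.ne_of_mem_erase hy).symm _

-- The cases are the roles of `u` and of the neighbour `w` of `v` relative to the eligible pair.
-- Each costs one degree choice and at most one codegree choice. The vertex `v` itself may lie on
-- the path; then a codegree bound for it is unavailable, but one choice fewer is needed, which
-- gives the separate terms with `v` prescribed. If `u` and `w` are both centres, `y` is absorbed by
-- `doubleStarSets`.
set_option maxHeartbeats 400000 in
theorem card_eligible_edge_le {C : Finset V} {Δ D : ℕ} {G : SimpleGraph V}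
    (hG : DegBounded Δ D G) (hGC : ∀ x y, G.Adj x y → y ∉ C)
    {u v : V} (huv : u ≠ v) (hu : u ∉ C) (F : Finset (Finset V))
    (hF : ∀ S ∈ F, S.card = C.card + 2 ∧ Eligible C G S ∧ u ∈ S ∧
      ∃ w ∈ S, w ≠ u ∧ G.Adj v w) :
    F.card ≤ Δ + Δ * (D * (C.card + D) ^ (C.card - 1)) + Δ * (C.card + D) ^ (C.card - 1)
      + D * (Δ * (C.card + D) ^ (C.card - 1)) + D * (Δ * (C.card + D) ^ (C.card - 1))
      + Δ * (D * (C.card + D) ^ (C.card - 1)) + Δ * (C.card + D) ^ (C.card - 1) := by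
  have hcover : F ⊆ ((nb G v).image fun w => insert u (insert w C)) ∪
      (((nb G u).erase v).biUnion fun z => ((nb G z ∩ nb G v).erase u).biUnion
        fun w => starSets C G u z w) ∪
      (((nb G v).erase u).biUnion fun w => starSets C G u v w) ∪
      ((nb G u ∩ nb G v).biUnion fun w => ((nb G w).erase u).biUnion
        fun y => starSets C G u w y) ∪
      ((nb G u ∩ nb G v).biUnion fun w => ((nb G u).erase w).biUnion
        fun y => starSets C G w u y) ∪
      (((nb G u).erase v).biUnion fun x => ((nb G x ∩ nb G v).erase u).biUnion
        fun w => ((nb G u ∩ nb G w).erase x).biUnion fun y => doubleStarSets C G x u w y) ∪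
      (((nb G v).erase u).biUnion fun w => ((nb G u ∩ nb G w).erase v).biUnion
        fun y => doubleStarSets C G v u w y) := by
    intro S hSF
    obtain ⟨hS, ⟨x, y, h⟩, huS, w, hwS, hwu, hvw⟩ := hF S hSF
    have hwC := hGC _ _ hvw
    have hwv := mem_nb.2 hvw
    have key1 : EligPair C G S u w → S ∈ ((nb G v).image fun w => insert u (insert w C)) ∪
      (((nb G u).erase v).biUnion fun z => ((nb G z ∩ nb G v).erase u).biUnion
        fun w => starSets C G u z w) ∪
      (((nb G v).erase u).biUnion fun w => starSets C G u v w) := by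
      intro h
      rcases h.eq_or_exists hS with h' | ⟨z, hz, hzC, hzx, hzy⟩
      · exact Finset.mem_union_left _ (Finset.mem_union_left _
          (Finset.mem_image.2 ⟨w, hwv, h'.symm⟩))
      · have ha := h.adj z hz hzC hzx hzy
        by_cases hzv : z = v
        · subst hzv
          exact Finset.mem_union_right _ (Finset.mem_biUnion.2
            ⟨w, Finset.mem_erase.2 ⟨hwu, hwv⟩, h.mem_starSets hS hz hzx hzy⟩)
        · exact Finset.mem_union_left _ (Finset.mem_union_right _ (Finset.mem_biUnion.2
            ⟨z, Finset.mem_erase.2 ⟨hzv, mem_nb.2 ha.1.symm⟩, Finset.mem_biUnion.2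
            ⟨w, Finset.mem_erase.2 ⟨hwu, Finset.mem_inter.2 ⟨mem_nb.2 ha.2, hwv⟩⟩,
              h.mem_starSets hS hz hzx hzy⟩⟩))
    have key2 : ∀ y, y ≠ w → EligPair C G S u y →
        S ∈ ((nb G u ∩ nb G v).biUnion fun w => ((nb G w).erase u).biUnion
        fun y => starSets C G u w y) := by
      intro y hyw h
      have ha := h.adj w hwS hwC hwu hyw.symm
      exact Finset.mem_biUnion.2 ⟨w, Finset.mem_inter.2 ⟨mem_nb.2 ha.1.symm, hwv⟩,
        Finset.mem_biUnion.2 ⟨y, Finset.mem_erase.2 ⟨h.ne.symm, mem_nb.2 ha.2⟩,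
        h.mem_starSets hS hwS hwu hyw.symm⟩⟩
    have key3 : ∀ y, y ≠ u → EligPair C G S w y →
        S ∈ ((nb G u ∩ nb G v).biUnion fun w => ((nb G u).erase w).biUnion
        fun y => starSets C G w u y) := by
      intro y hyu h
      have ha := h.adj u huS hu hwu.symm hyu.symm
      exact Finset.mem_biUnion.2 ⟨w, Finset.mem_inter.2 ⟨mem_nb.2 ha.1, hwv⟩,
        Finset.mem_biUnion.2 ⟨y, Finset.mem_erase.2 ⟨h.ne.symm, mem_nb.2 ha.2⟩,
        h.mem_starSets hS huS hwu.symm hyu.symm⟩⟩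
    by_cases hxu : x = u
    · subst hxu
      by_cases hyw : y = w
      · subst hyw
        exact Finset.mem_union_left _ <| Finset.mem_union_left _ <| Finset.mem_union_left _ <|
          Finset.mem_union_left _ <| key1 h
      · exact Finset.mem_union_left _ <| Finset.mem_union_left _ <| Finset.mem_union_left _ <|
          Finset.mem_union_right _ <| key2 y hyw h
    by_cases hyu : y = u
    · subst hyu
      by_cases hxw : x = w
      · subst hxw
        exact Finset.mem_union_left _ <| Finset.mem_union_left _ <| Finset.mem_union_left _ <|
          Finset.mem_union_left _ <| key1 h.symm
      · exact Finset.mem_union_left _ <| Finset.mem_union_left _ <| Finset.mem_union_left _ <|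
          Finset.mem_union_right _ <| key2 x hxw h.symm
    by_cases hxw : x = w
    · subst hxw
      exact Finset.mem_union_left _ <| Finset.mem_union_left _ <| Finset.mem_union_right _ <|
        key3 y hyu h
    by_cases hyw : y = w
    · subst hyw
      exact Finset.mem_union_left _ <| Finset.mem_union_left _ <| Finset.mem_union_right _ <|
        key3 x hxu h.symm
    have ha := h.adj u huS hu (Ne.symm hxu) (Ne.symm hyu)
    have hb := h.adj w hwS hwC (Ne.symm hxw) (Ne.symm hyw)
    have hm := h.mem_doubleStarSets hS huS (Ne.symm hxu) (Ne.symm hyu) hwS (Ne.symm hxw)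
      (Ne.symm hyw) hwu
    by_cases hxv : x = v
    · subst hxv
      refine Finset.mem_union_right _ (Finset.mem_biUnion.2 ⟨w, Finset.mem_erase.2 ⟨hwu, hwv⟩,
        Finset.mem_biUnion.2 ⟨y, Finset.mem_erase.2 ⟨h.ne.symm, Finset.mem_inter.2
        ⟨mem_nb.2 ha.2, mem_nb.2 hb.2⟩⟩, hm⟩⟩)
    · refine Finset.mem_union_left _ (Finset.mem_union_right _ (Finset.mem_biUnion.2
        ⟨x, Finset.mem_erase.2 ⟨hxv, mem_nb.2 ha.1⟩, Finset.mem_biUnion.2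
        ⟨w, Finset.mem_erase.2 ⟨hwu, Finset.mem_inter.2 ⟨mem_nb.2 hb.1.symm, hwv⟩⟩,
        Finset.mem_biUnion.2 ⟨y, Finset.mem_erase.2 ⟨h.ne.symm, Finset.mem_inter.2
        ⟨mem_nb.2 ha.2, mem_nb.2 hb.2⟩⟩, hm⟩⟩⟩))
  have hdouble : ∀ x w, w ≠ u → (((nb G u ∩ nb G w).erase x).biUnion
      fun y => doubleStarSets C G x u w y).card ≤ (C.card + D) ^ (C.card - 1) := by
    intro x w hwu
    refine Finset.card_biUnion_le.trans ?_
    rcases Nat.eq_zero_or_pos D with hD | hD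
    · have : (nb G u ∩ nb G w).erase x = ∅ := by
        rw [← Finset.card_eq_zero]
        have := (Finset.card_erase_le (s := nb G u ∩ nb G w) (a := x)).trans (hG.2 u w hwu.symm)
        omega
      simp [this]
    · refine Nat.le_of_mul_le_mul_left ?_ hD
      rw [Finset.mul_sum]
      refine (Finset.sum_le_card_nsmul _ _ _ fun y hy =>
        mul_card_doubleStarSets_le hG (Finset.ne_of_mem_erase hy).symm u w).trans ?_
      rw [smul_eq_mul]
      exact Nat.mul_le_mul_right _ ((Finset.card_erase_le).trans (hG.2 u w hwu.symm))
  refine (Finset.card_le_card hcover).trans ?_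
  refine card_union_le_of_le (card_union_le_of_le (card_union_le_of_le
    (card_union_le_of_le (card_union_le_of_le (card_union_le_of_le ?_ ?_) ?_) ?_) ?_) ?_) ?_
  · exact Finset.card_image_le.trans (hG.1 v)
  · refine card_biUnion_le_mul ((Finset.card_erase_le).trans (hG.1 _)) fun z hz => ?_
    refine card_biUnion_le_mul ((Finset.card_erase_le).trans
      (hG.2 _ _ (Finset.ne_of_mem_erase hz))) fun w hw => ?_
    exact card_starSets_le hG (Finset.ne_of_mem_erase hw).symm _
  · exact card_biUnion_le_mul ((Finset.card_erase_le).trans (hG.1 _)) fun y hy =>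
      card_starSets_le hG (Finset.ne_of_mem_erase hy).symm _
  · refine card_biUnion_le_mul (hG.2 u v huv) fun x _ => ?_
    exact card_biUnion_le_mul ((Finset.card_erase_le).trans (hG.1 _)) fun y hy =>
      card_starSets_le hG (Finset.ne_of_mem_erase hy).symm _
  · refine card_biUnion_le_mul (hG.2 u v huv) fun x _ => ?_
    exact card_biUnion_le_mul ((Finset.card_erase_le).trans (hG.1 _)) fun y hy =>
      card_starSets_le hG (Finset.ne_of_mem_erase hy).symm _
  · refine card_biUnion_le_mul ((Finset.card_erase_le).trans (hG.1 _)) fun x hx => ?_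
    refine card_biUnion_le_mul ((Finset.card_erase_le).trans
      (hG.2 _ _ (Finset.ne_of_mem_erase hx))) fun w hw => ?_
    exact hdouble x w (Finset.ne_of_mem_erase hw)
  · refine card_biUnion_le_mul ((Finset.card_erase_le).trans (hG.1 _)) fun w hw => ?_
    exact hdouble v w (Finset.ne_of_mem_erase hw)

/-- The addition of all pairs in `S` to `G` may create a common neighbour of `u` and `v`. -/
def CodegRelevant (G : SimpleGraph V) (u v : V) (S : Finset V) : Prop :=
  (u ∈ S ∧ v ∈ S) ∨ (u ∈ S ∧ ∃ w ∈ S, w ≠ u ∧ G.Adj v w) ∨ (v ∈ S ∧ ∃ w ∈ S, w ≠ v ∧ G.Adj u w)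

theorem CodegRelevant.mono {G G' : SimpleGraph V} (hG : G ≤ G') {u v : V} {S : Finset V}
    (h : CodegRelevant G u v S) : CodegRelevant G' u v S := by
  rcases h with h | ⟨h1, w, h2, h3, h4⟩ | ⟨h1, w, h2, h3, h4⟩
  · exact Or.inl h
  · exact Or.inr (Or.inl ⟨h1, w, h2, h3, hG h4⟩)
  · exact Or.inr (Or.inr ⟨h1, w, h2, h3, hG h4⟩)

theorem card_codegRelevant_le {C : Finset V} {Δ D : ℕ} {G : SimpleGraph V}
    (hG : DegBounded Δ D G) (hGC : ∀ x y, G.Adj x y → y ∉ C) (hC : 1 ≤ C.card)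
    (hD : 1 ≤ D) (hDΔ : D ≤ Δ) {u v : V} (huv : u ≠ v) (hu : u ∉ C) (hv : v ∉ C)
    (F : Finset (Finset V))
    (hF : ∀ S ∈ F, S.card = C.card + 2 ∧ Eligible C G S ∧ CodegRelevant G u v S) :
    F.card ≤ 19 * (Δ * D * (C.card + D) ^ (C.card - 1)) := by
  have hcover : F ⊆ {S ∈ F | u ∈ S ∧ v ∈ S} ∪ {S ∈ F | u ∈ S ∧ ∃ w ∈ S, w ≠ u ∧ G.Adj v w} ∪
      {S ∈ F | v ∈ S ∧ ∃ w ∈ S, w ≠ v ∧ G.Adj u w} := by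
    intro S hS
    have := (hF S hS).2.2
    simp only [Finset.mem_union, Finset.mem_filter]
    rcases this with h | h | h <;> simp [hS, h]
  have h1 := card_eligible_pair_le hG huv hu hv {S ∈ F | u ∈ S ∧ v ∈ S} (fun S hS => by
    rw [Finset.mem_filter] at hS; exact ⟨(hF S hS.1).1, (hF S hS.1).2.1, hS.2⟩)
  have h2 := card_eligible_edge_le hG hGC huv hu {S ∈ F | u ∈ S ∧ ∃ w ∈ S, w ≠ u ∧ G.Adj v w}
    (fun S hS => by
      rw [Finset.mem_filter] at hS; exact ⟨(hF S hS.1).1, (hF S hS.1).2.1, hS.2⟩)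
  have h3 := card_eligible_edge_le hG hGC huv.symm hv
    {S ∈ F | v ∈ S ∧ ∃ w ∈ S, w ≠ v ∧ G.Adj u w}
    (fun S hS => by
      rw [Finset.mem_filter] at hS; exact ⟨(hF S hS.1).1, (hF S hS.1).2.1, hS.2⟩)
  refine (Finset.card_le_card hcover).trans ((card_union_le_of_le
    (card_union_le_of_le h1 h2) h3).trans ?_)
  generalize hK : (C.card + D) ^ (C.card - 1) = K
  have hK1 : 1 ≤ K := hK ▸ Nat.one_le_pow _ _ (by omega)
  have hΔ : 1 ≤ Δ := hD.trans hDΔ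
  have a1 : Δ * K ≤ Δ * D * K := Nat.mul_le_mul_right _ (Nat.le_mul_of_pos_right _ hD)
  have a2 : D * K ≤ Δ * K := Nat.mul_le_mul_right _ hDΔ
  have a3 : Δ ≤ Δ * K := Nat.le_mul_of_pos_right _ hK1
  have a4 : D * (D * K) ≤ Δ * D * K := by
    rw [← mul_assoc]; exact Nat.mul_le_mul_right _ (Nat.mul_le_mul_right _ hDΔ)
  have a5 : Δ * (D * K) = Δ * D * K := by ring
  have a6 : D * (Δ * K) = Δ * D * K := by ring
  rw [a5, a6]
  -- Each of the `5 + 7 + 7 = 19` summands is at most `Δ * D * K`.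
  omega

end Counting

/-! ### An exponential tail bound for explorations. -/

/-- Here `N` counts relevant tests, and only a successful relevant test increases `X`, by at most
`r`. Thus `exp (X / r - 2pN)` is a supermartingale starting at most at `1`, and Markov's inequality
applies. Further growth of `N` only decreases it. -/
theorem bernSum_exp_tail {ι : Type*} [DecidableEq ι] {p : ℝ} (h0 : 0 ≤ p) (h1 : p ≤ 1)
    {U : Finset ι} {next : Finset ι → Finset ι → Option ι}
    (hnext : ∀ R Y i, next R Y = some i → i ∈ U \ R)
    (X : Finset ι → ℕ) (N : Finset ι → Finset ι → ℕ) {r : ℕ} (hr : 0 < r) (t M : ℕ)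
    (hX : X ∅ = 0) (hM : ∀ A ⊆ U, N (exploreFinal next U A).1 (exploreFinal next U A).2 ≤ M)
    (hstep : ∀ R Y i, next R Y = some i →
      (N R Y + 1 ≤ N (insert i R) Y ∧ N R Y + 1 ≤ N (insert i R) (insert i Y) ∧
        X (insert i Y) ≤ X Y + r) ∨
      (N R Y ≤ N (insert i R) Y ∧ N R Y ≤ N (insert i R) (insert i Y) ∧ X (insert i Y) ≤ X Y)) :
    bernSum p U (fun A => if t < X (exploreFinal next U A).2 then 1 else 0) ≤
      Real.exp (2 * p * M - t / r) := by
  have hr' : (0 : ℝ) < r := by exact_mod_cast hr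
  set Φ : Finset ι × Finset ι → ℝ := fun s => Real.exp (X s.2 / r - 2 * p * N s.1 s.2) with hΦ
  have main : bernSum p U (fun A => Φ (exploreFinal next U A)) ≤ 1 := by
    refine (bernSum_exploreFinal_le h0 h1 hnext Φ ?_).trans ?_
    · intro R Y i _ hi
      rcases hstep R Y i hi with ⟨a, b, c⟩ | ⟨a, b, c⟩
      · have a' : (N R Y : ℝ) + 1 ≤ N (insert i R) Y := by exact_mod_cast a
        have b' : (N R Y : ℝ) + 1 ≤ N (insert i R) (insert i Y) := by exact_mod_cast b
        have c' : (X (insert i Y) : ℝ) ≤ X Y + r := by exact_mod_cast c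
        have c2 : (X (insert i Y) : ℝ) / r ≤ X Y / r + 1 := by
          rw [div_add_one hr'.ne']; gcongr
        have e1 : Φ (insert i R, Y) ≤ Φ (R, Y) * Real.exp (-(2 * p)) := by
          simp only [hΦ, ← Real.exp_add]
          refine Real.exp_le_exp.2 ?_
          nlinarith
        have e2 : Φ (insert i R, insert i Y) ≤ Φ (R, Y) * Real.exp (-(2 * p)) * Real.exp 1 := by
          simp only [hΦ, ← Real.exp_add]
          refine Real.exp_le_exp.2 ?_
          nlinarith
        -- Since `e < 3`, the left side is at most `1 + 2p`.
        have e3 : (1 - p + p * Real.exp 1) ≤ Real.exp (2 * p) := by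
          have := Real.exp_one_lt_d9
          have := Real.add_one_le_exp (2 * p)
          nlinarith
        have hpos : 0 < Φ (R, Y) := Real.exp_pos _
        calc (1 - p) * Φ (insert i R, Y) + p * Φ (insert i R, insert i Y)
            ≤ (1 - p) * (Φ (R, Y) * Real.exp (-(2 * p))) +
              p * (Φ (R, Y) * Real.exp (-(2 * p)) * Real.exp 1) :=
              add_le_add (mul_le_mul_of_nonneg_left e1 (by linarith))
                (mul_le_mul_of_nonneg_left e2 h0)
          _ = Φ (R, Y) * (Real.exp (-(2 * p)) * (1 - p + p * Real.exp 1)) := by ring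
          _ ≤ Φ (R, Y) * (Real.exp (-(2 * p)) * Real.exp (2 * p)) := by gcongr
          _ = Φ (R, Y) := by rw [← Real.exp_add]; simp
      · have a' : (N R Y : ℝ) ≤ N (insert i R) Y := by exact_mod_cast a
        have b' : (N R Y : ℝ) ≤ N (insert i R) (insert i Y) := by exact_mod_cast b
        have c' : (X (insert i Y) : ℝ) / r ≤ X Y / r := by gcongr
        have e1 : Φ (insert i R, Y) ≤ Φ (R, Y) := by
          simp only [hΦ]
          refine Real.exp_le_exp.2 ?_
          nlinarith
        have e2 : Φ (insert i R, insert i Y) ≤ Φ (R, Y) := by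
          simp only [hΦ]
          refine Real.exp_le_exp.2 ?_
          nlinarith
        nlinarith
    · simp only [hΦ, hX]
      rw [Real.exp_le_one_iff]
      have : 0 ≤ 2 * p * (N ∅ ∅ : ℝ) := by positivity
      simp only [Nat.cast_zero, zero_div]
      linarith
  calc bernSum p U (fun A => if t < X (exploreFinal next U A).2 then 1 else 0)
      ≤ bernSum p U (fun A => Real.exp (2 * p * M - t / r) * Φ (exploreFinal next U A)) := by
        refine bernSum_mono h0 h1 fun A hA => ?_
        split_ifs with h
        · simp only [hΦ, ← Real.exp_add]
          rw [Real.one_le_exp_iff]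
          have h2 : (N (exploreFinal next U A).1 (exploreFinal next U A).2 : ℝ) ≤ M := by
            exact_mod_cast hM A hA
          have h3 : (t : ℝ) / r ≤ X (exploreFinal next U A).2 / r := by
            have : (t : ℝ) ≤ X (exploreFinal next U A).2 := by exact_mod_cast h.le
            gcongr
          nlinarith
        · positivity
    _ ≤ _ := by
        rw [bernSum_const_mul]
        exact mul_le_of_le_one_right (Real.exp_pos _).le main

/-! ### Exploring the closure of the hypergraph; tails of degrees and codegrees. -/

section Exploration

open scoped Classical

set_option linter.unusedSectionVars false

variable {V : Type*} [Fintype V] [DecidableEq V]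

/-- The graph outside `C` in which all pairs of vertices of members of `Y` are adjacent. -/
def outerGraph (C : Finset V) (Y : Finset (Finset V)) : SimpleGraph V where
  Adj x y := x ≠ y ∧ x ∉ C ∧ y ∉ C ∧ ∃ S ∈ Y, x ∈ S ∧ y ∈ S
  symm := ⟨fun _ _ ⟨h1, h2, h3, S, h4, h5, h6⟩ => ⟨h1.symm, h3, h2, S, h4, h6, h5⟩⟩
  loopless := ⟨fun _ h => h.1 rfl⟩

theorem outerGraph_mono (C : Finset V) {Y Y' : Finset (Finset V)} (h : Y ⊆ Y') :
    outerGraph C Y ≤ outerGraph C Y' :=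
  fun _ _ ⟨h1, h2, h3, S, h4, h5⟩ => ⟨h1, h2, h3, S, h h4, h5⟩

theorem outerGraph_insert_adj {C : Finset V} {Y : Finset (Finset V)} {S : Finset V} {x y : V}
    (h : (outerGraph C (insert S Y)).Adj x y) : (outerGraph C Y).Adj x y ∨ (x ∈ S ∧ y ∈ S) := by
  obtain ⟨h1, h2, h3, T, h4, h5⟩ := h
  rcases Finset.mem_insert.1 h4 with rfl | h4
  · exact Or.inr h5
  · exact Or.inl ⟨h1, h2, h3, T, h4, h5⟩

theorem nb_outerGraph_empty (C : Finset V) (v : V) : nb (outerGraph C ∅) v = ∅ := by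
  ext w; simp [mem_nb, outerGraph]

theorem nb_outerGraph_of_mem {C : Finset V} (Y : Finset (Finset V)) {v : V} (hv : v ∈ C) :
    nb (outerGraph C Y) v = ∅ := by
  ext w; simp [mem_nb, outerGraph, hv]

theorem nb_insert_subset (C : Finset V) (Y : Finset (Finset V)) (S : Finset V) (v : V) :
    nb (outerGraph C (insert S Y)) v ⊆ nb (outerGraph C Y) v ∪ S := by
  intro w hw
  rcases outerGraph_insert_adj (mem_nb.1 hw) with h | h
  · exact Finset.mem_union_left _ (mem_nb.2 h)
  · exact Finset.mem_union_right _ h.2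

theorem nb_insert_subset_of_notMem (C : Finset V) (Y : Finset (Finset V)) {S : Finset V} {v : V}
    (hv : v ∉ S) : nb (outerGraph C (insert S Y)) v ⊆ nb (outerGraph C Y) v := by
  intro w hw
  rcases outerGraph_insert_adj (mem_nb.1 hw) with h | h
  · exact mem_nb.2 h
  · exact absurd h.1 hv

theorem codeg_insert_subset (C : Finset V) (Y : Finset (Finset V)) (S : Finset V) (u v : V) :
    nb (outerGraph C (insert S Y)) u ∩ nb (outerGraph C (insert S Y)) v ⊆
      (nb (outerGraph C Y) u ∩ nb (outerGraph C Y) v) ∪ S := by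
  intro w hw
  obtain ⟨h1, h2⟩ := Finset.mem_inter.1 hw
  rcases outerGraph_insert_adj (mem_nb.1 h1) with h1 | h1
  · rcases outerGraph_insert_adj (mem_nb.1 h2) with h2 | h2
    · exact Finset.mem_union_left _ (Finset.mem_inter.2 ⟨mem_nb.2 h1, mem_nb.2 h2⟩)
    · exact Finset.mem_union_right _ h2.2
  · exact Finset.mem_union_right _ h1.2

theorem codeg_insert_subset_of_not_relevant (C : Finset V) (Y : Finset (Finset V)) {S : Finset V}
    {u v : V} (h : ¬ CodegRelevant (outerGraph C Y) u v S) :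
    nb (outerGraph C (insert S Y)) u ∩ nb (outerGraph C (insert S Y)) v ⊆
      nb (outerGraph C Y) u ∩ nb (outerGraph C Y) v := by
  intro w hw
  obtain ⟨h1, h2⟩ := Finset.mem_inter.1 hw
  have h1' := (mem_nb.1 h1).ne
  have h2' := (mem_nb.1 h2).ne
  rcases outerGraph_insert_adj (mem_nb.1 h1) with h1 | h1
  · rcases outerGraph_insert_adj (mem_nb.1 h2) with h2 | h2
    · exact Finset.mem_inter.2 ⟨mem_nb.2 h1, mem_nb.2 h2⟩
    · exact absurd (Or.inr (Or.inr ⟨h2.1, w, h2.2, h2'.symm, h1⟩)) h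
  · rcases outerGraph_insert_adj (mem_nb.1 h2) with h2 | h2
    · exact absurd (Or.inr (Or.inl ⟨h1.1, w, h1.2, h1'.symm, h2⟩)) h
    · exact absurd (Or.inl ⟨h1.1, h2.1⟩) h

/-- All sets of `#C + 2` vertices. -/
def potentialEdges (C : Finset V) : Finset (Finset V) :=
  Finset.univ.powersetCard (C.card + 2)

theorem mem_potentialEdges {C S : Finset V} : S ∈ potentialEdges C ↔ S.card = C.card + 2 := by
  simp [potentialEdges, Finset.mem_powersetCard]

/-- As long as degrees and codegrees are bounded, some eligible set is tested. -/
noncomputable def nextTest (C : Finset V) (Δ D : ℕ) (R Y : Finset (Finset V)) :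
    Option (Finset V) :=
  if h : DegBounded Δ D (outerGraph C Y) ∧
      ∃ S, S ∈ potentialEdges C \ R ∧ Eligible C (outerGraph C Y) S
    then some h.2.choose else none

theorem nextTest_eq_some {C : Finset V} {Δ D : ℕ} {R Y : Finset (Finset V)} {S : Finset V}
    (h : nextTest C Δ D R Y = some S) : DegBounded Δ D (outerGraph C Y) ∧
      S ∈ potentialEdges C \ R ∧ Eligible C (outerGraph C Y) S := by
  unfold nextTest at h
  split_ifs at h with h'
  rw [Option.some.injEq] at h
  exact ⟨h'.1, h ▸ h'.2.choose_spec⟩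

theorem nextTest_eq_none {C : Finset V} {Δ D : ℕ} {R Y : Finset (Finset V)}
    (h : nextTest C Δ D R Y = none) (hb : DegBounded Δ D (outerGraph C Y)) {S : Finset V}
    (hS : S ∈ potentialEdges C) (he : Eligible C (outerGraph C Y) S) : S ∈ R := by
  unfold nextTest at h
  split_ifs at h with h'
  by_contra hR
  exact h' ⟨hb, S, Finset.mem_sdiff.2 ⟨hS, hR⟩, he⟩

theorem nextTest_mem {C : Finset V} {Δ D : ℕ} (R Y : Finset (Finset V)) (S : Finset V)
    (h : nextTest C Δ D R Y = some S) : S ∈ potentialEdges C \ R := (nextTest_eq_some h).2.1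

/-- The final state of the exploration: the sets tested and those found among the hyperedges. -/
noncomputable def finalState (C : Finset V) (Δ D : ℕ) (A : Finset (Finset V)) :
    Finset (Finset V) × Finset (Finset V) :=
  exploreFinal (nextTest C Δ D) (potentialEdges C) A

/-- Tests are made only while the bounds hold, so they are overshot by at most one hyperedge, that
is, by `C.card + 2`. Hence the counting lemmas apply to the final state even when the exploration
was cut short. Eligibility persists because the graph only grows. -/
theorem finalState_spec (C : Finset V) (Δ D : ℕ) (A : Finset (Finset V)) :
    (finalState C Δ D A).2 = A ∩ (finalState C Δ D A).1 ∧
    (finalState C Δ D A).1 ⊆ potentialEdges C ∧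
    (∀ S ∈ (finalState C Δ D A).1, Eligible C (outerGraph C (finalState C Δ D A).2) S) ∧
    DegBounded (Δ + (C.card + 2)) (D + (C.card + 2)) (outerGraph C (finalState C Δ D A).2) := by
  refine exploreFinal_induction (P := fun R Y => Y = A ∩ R ∧ R ⊆ potentialEdges C ∧
    (∀ S ∈ R, Eligible C (outerGraph C Y) S) ∧
    DegBounded (Δ + (C.card + 2)) (D + (C.card + 2)) (outerGraph C Y)) ?_ ?_
  · refine ⟨by simp, by simp, by simp, ?_, ?_⟩
    · intro v; rw [nb_outerGraph_empty]; simp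
    · intro u v _; rw [nb_outerGraph_empty]; simp
  · rintro R Y S ⟨hY, hR, hE, hB⟩ hS
    obtain ⟨hb, hSU, hSE⟩ := nextTest_eq_some hS
    obtain ⟨hSU, hSR⟩ := Finset.mem_sdiff.1 hSU
    have hcard := mem_potentialEdges.1 hSU
    have hY' : Y ⊆ if S ∈ A then insert S Y else Y := by
      split_ifs
      · exact Finset.subset_insert _ _
      · exact subset_rfl
    refine ⟨?_, Finset.insert_subset hSU hR, ?_, ?_⟩
    · split_ifs with h
      · rw [Finset.inter_insert_of_mem h, hY]
      · rw [Finset.inter_insert_of_notMem h, hY]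
    · intro T hT
      rcases Finset.mem_insert.1 hT with rfl | hT
      · exact hSE.mono (outerGraph_mono C hY')
      · exact (hE T hT).mono (outerGraph_mono C hY')
    · split_ifs with h
      · refine ⟨fun v => ?_, fun u v huv => ?_⟩
        · exact (Finset.card_le_card (nb_insert_subset C Y S v)).trans
            (card_union_le_of_le (hb.1 v) hcard.le)
        · exact (Finset.card_le_card (codeg_insert_subset C Y S u v)).trans
            (card_union_le_of_le (hb.2 u v huv) hcard.le)
      · exact hB

theorem card_biUnion_product_le {Y : Finset (Finset V)} {r : ℕ}
    (hY : ∀ S ∈ Y, S.card = r) :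
    (Y.biUnion fun S => S ×ˢ S).card ≤ Y.card * (r * r) := by
  refine card_biUnion_le_mul le_rfl fun S hS => ?_
  rw [Finset.card_product, hY S hS]

theorem bernSum_degree_tail {p : ℝ} (h0 : 0 ≤ p) (h1 : p ≤ 1) (C : Finset V) (Δ D : ℕ) (v : V) :
    bernSum p (potentialEdges C)
      (fun A => if Δ < (nb (outerGraph C (finalState C Δ D A).2) v).card then 1 else 0) ≤
    Real.exp (2 * p * ((Fintype.card V + 2 * ((Δ + (C.card + 2)) * ((Δ + (C.card + 2)) *
      (C.card + (D + (C.card + 2))) ^ (C.card - 1))) : ℕ) : ℝ) - Δ / (C.card + 2 : ℕ)) := by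
  by_cases hv : v ∈ C
  · simp only [nb_outerGraph_of_mem _ hv, Finset.card_empty, Nat.not_lt_zero, if_false]
    rw [bernSum_const]
    positivity
  refine bernSum_exp_tail h0 h1 nextTest_mem (fun Y => (nb (outerGraph C Y) v).card)
    (fun R _ => {S ∈ R | v ∈ S}.card) (by omega) Δ _ ?_ ?_ ?_
  · simp [nb_outerGraph_empty]
  · intro A _
    obtain ⟨-, h2, h3, h4⟩ := finalState_spec C Δ D A
    refine card_eligible_mem_le h4 hv _ fun S hS => ?_
    obtain ⟨hS, hvS⟩ := Finset.mem_filter.1 hS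
    exact ⟨mem_potentialEdges.1 (h2 hS), h3 S hS, hvS⟩
  · intro R Y S hS
    obtain ⟨-, hSU, -⟩ := nextTest_eq_some hS
    obtain ⟨hSU, hSR⟩ := Finset.mem_sdiff.1 hSU
    by_cases hvS : v ∈ S
    · left
      have : {T ∈ insert S R | v ∈ T}.card = {T ∈ R | v ∈ T}.card + 1 := by
        rw [Finset.filter_insert, if_pos hvS, Finset.card_insert_of_notMem (by simp [hSR])]
      exact ⟨this.ge, this.ge, (Finset.card_le_card (nb_insert_subset C Y S v)).trans
        (card_union_le_of_le le_rfl (mem_potentialEdges.1 hSU).le)⟩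
    · right
      have : {T ∈ R | v ∈ T}.card ≤ {T ∈ insert S R | v ∈ T}.card :=
        Finset.card_le_card (Finset.filter_subset_filter _ (Finset.subset_insert _ _))
      exact ⟨this, this, Finset.card_le_card (nb_insert_subset_of_notMem C Y hvS)⟩

theorem bernSum_codegree_tail {p : ℝ} (h0 : 0 ≤ p) (h1 : p ≤ 1) {C : Finset V}
    (hC : 1 ≤ C.card) {Δ D : ℕ} (hDΔ : D ≤ Δ) {u v : V} (huv : u ≠ v) :
    bernSum p (potentialEdges C)
      (fun A => if D < (nb (outerGraph C (finalState C Δ D A).2) u ∩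
        nb (outerGraph C (finalState C Δ D A).2) v).card then 1 else 0) ≤
    Real.exp (2 * p * ((19 * ((Δ + (C.card + 2)) * (D + (C.card + 2)) *
      (C.card + (D + (C.card + 2))) ^ (C.card - 1)) : ℕ) : ℝ) - D / (C.card + 2 : ℕ)) := by
  by_cases hu : u ∈ C
  · simp only [nb_outerGraph_of_mem _ hu, Finset.empty_inter, Finset.card_empty, Nat.not_lt_zero,
      if_false]
    rw [bernSum_const]
    positivity
  by_cases hv : v ∈ C
  · simp only [nb_outerGraph_of_mem _ hv, Finset.inter_empty, Finset.card_empty, Nat.not_lt_zero,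
      if_false]
    rw [bernSum_const]
    positivity
  refine bernSum_exp_tail h0 h1 nextTest_mem
    (fun Y => (nb (outerGraph C Y) u ∩ nb (outerGraph C Y) v).card)
    (fun R Y => {S ∈ R | CodegRelevant (outerGraph C Y) u v S}.card) (by omega) D _ ?_ ?_ ?_
  · simp [nb_outerGraph_empty]
  · intro A _
    obtain ⟨-, h2, h3, h4⟩ := finalState_spec C Δ D A
    refine card_codegRelevant_le h4 (fun x y h => h.2.2.1) hC (by omega) (by omega) huv hu hv _
      fun S hS => ?_
    obtain ⟨hS, hvS⟩ := Finset.mem_filter.1 hS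
    exact ⟨mem_potentialEdges.1 (h2 hS), h3 S hS, hvS⟩
  · intro R Y S hS
    obtain ⟨-, hSU, -⟩ := nextTest_eq_some hS
    obtain ⟨hSU, hSR⟩ := Finset.mem_sdiff.1 hSU
    -- Relevance depends on the current graph: a success may make earlier tests relevant in
    -- retrospect, which only increases the counter.
    have hmono : ∀ R' : Finset (Finset V), {T ∈ R' | CodegRelevant (outerGraph C Y) u v T}.card ≤
        {T ∈ R' | CodegRelevant (outerGraph C (insert S Y)) u v T}.card := fun R' =>
      Finset.card_le_card (Finset.monotone_filter_right _ fun T _ hT =>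
        CodegRelevant.mono (outerGraph_mono C (Finset.subset_insert _ _)) hT)
    by_cases hvS : CodegRelevant (outerGraph C Y) u v S
    · left
      have : {T ∈ insert S R | CodegRelevant (outerGraph C Y) u v T}.card =
          {T ∈ R | CodegRelevant (outerGraph C Y) u v T}.card + 1 := by
        rw [Finset.filter_insert, if_pos hvS, Finset.card_insert_of_notMem (by simp [hSR])]
      exact ⟨this.ge, this.ge.trans (hmono _),
        (Finset.card_le_card (codeg_insert_subset C Y S u v)).trans
          (card_union_le_of_le le_rfl (mem_potentialEdges.1 hSU).le)⟩
    · right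
      have : {T ∈ R | CodegRelevant (outerGraph C Y) u v T}.card ≤
          {T ∈ insert S R | CodegRelevant (outerGraph C Y) u v T}.card :=
        Finset.card_le_card (Finset.filter_subset_filter _ (Finset.subset_insert _ _))
      exact ⟨this, this.trans (hmono _),
        Finset.card_le_card (codeg_insert_subset_of_not_relevant C Y hvS)⟩

theorem bernSum_not_degBounded_le {p : ℝ} (h0 : 0 ≤ p) (h1 : p ≤ 1) {C : Finset V}
    (hC : 1 ≤ C.card) {Δ D : ℕ} (hDΔ : D ≤ Δ) :
    bernSum p (potentialEdges C)
      (fun A => if DegBounded Δ D (outerGraph C (finalState C Δ D A).2) then 0 else 1) ≤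
    Fintype.card V * Real.exp (2 * p * ((Fintype.card V + 2 * ((Δ + (C.card + 2)) *
      ((Δ + (C.card + 2)) * (C.card + (D + (C.card + 2))) ^ (C.card - 1))) : ℕ) : ℝ)
        - Δ / (C.card + 2 : ℕ)) +
    (Fintype.card V) ^ 2 * Real.exp (2 * p * ((19 * ((Δ + (C.card + 2)) * (D + (C.card + 2)) *
      (C.card + (D + (C.card + 2))) ^ (C.card - 1)) : ℕ) : ℝ) - D / (C.card + 2 : ℕ)) := by
  have hoff : ((Finset.univ : Finset V).offDiag.card : ℝ) ≤ (Fintype.card V : ℝ) ^ 2 := by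
    have : (Finset.univ : Finset V).offDiag.card ≤ Fintype.card V ^ 2 := by
      rw [Finset.offDiag_card, Finset.card_univ, sq]
      exact Nat.sub_le _ _
    exact_mod_cast this
  calc _ ≤ bernSum p (potentialEdges C) (fun A =>
        (∑ v : V, if Δ < (nb (outerGraph C (finalState C Δ D A).2) v).card then 1 else 0) +
        ∑ q ∈ (Finset.univ : Finset V).offDiag,
          if D < (nb (outerGraph C (finalState C Δ D A).2) q.1 ∩
        nb (outerGraph C (finalState C Δ D A).2) q.2).card then 1 else 0) := by
        refine bernSum_mono h0 h1 fun A _ => ?_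
        have hnn1 : ∀ v ∈ (Finset.univ : Finset V), (0 : ℝ) ≤
            if Δ < (nb (outerGraph C (finalState C Δ D A).2) v).card then 1 else 0 := by
          intro v _; split_ifs <;> simp
        have hnn2 : ∀ q ∈ (Finset.univ : Finset V).offDiag, (0 : ℝ) ≤
            if D < (nb (outerGraph C (finalState C Δ D A).2) q.1 ∩
              nb (outerGraph C (finalState C Δ D A).2) q.2).card then 1 else 0 := by
          intro v _; split_ifs <;> simp
        split_ifs with h
        · exact add_nonneg (Finset.sum_nonneg hnn1) (Finset.sum_nonneg hnn2)
        · rw [DegBounded, not_and_or] at h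
          push Not at h
          rcases h with ⟨v, hv⟩ | ⟨u, v, huv, hv⟩
          · refine le_add_of_le_of_nonneg ?_ (Finset.sum_nonneg hnn2)
            refine le_trans ?_ (Finset.single_le_sum hnn1 (Finset.mem_univ v))
            rw [if_pos hv]
          · refine le_add_of_nonneg_of_le (Finset.sum_nonneg hnn1) ?_
            refine le_trans ?_ (Finset.single_le_sum hnn2 (a := (u, v))
              (Finset.mem_offDiag.2 ⟨Finset.mem_univ _, Finset.mem_univ _, huv⟩))
            rw [if_pos hv]
    _ ≤ _ := by
        rw [bernSum_add, bernSum_sum, bernSum_sum]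
        refine add_le_add ?_ ?_
        · refine (Finset.sum_le_card_nsmul _ _ _ fun v _ =>
            bernSum_degree_tail h0 h1 C Δ D v).trans ?_
          rw [nsmul_eq_mul, Finset.card_univ]
        · refine (Finset.sum_le_card_nsmul _ _ _ fun q hq =>
            bernSum_codegree_tail h0 h1 hC hDΔ (Finset.mem_offDiag.1 hq).2.2).trans ?_
          rw [nsmul_eq_mul]
          gcongr

/-! ### Base hyperedges and the rarity of larger ones. -/

/-- The sets that consist of `C` and two further vertices. -/
def baseEdges (C : Finset V) : Finset (Finset V) :=
  (Cᶜ.powersetCard 2).image (· ∪ C)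

theorem card_baseEdges (C : Finset V) :
    (baseEdges C).card = (Fintype.card V - C.card).choose 2 := by
  rw [baseEdges, Finset.card_image_of_injOn, Finset.card_powersetCard, Finset.card_compl]
  intro s hs t ht hst
  have key : ∀ s ∈ (Cᶜ.powersetCard 2), (s ∪ C) \ C = s := by
    intro s hs
    rw [Finset.union_sdiff_right, Finset.sdiff_eq_self_iff_disjoint]
    exact Finset.disjoint_left.2 fun a ha hC =>
      (Finset.mem_compl.1 ((Finset.mem_powersetCard.1 hs).1 ha)) hC
  have := congrArg (· \ C) hst
  simpa [key s hs, key t ht] using this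

theorem baseEdges_subset (C : Finset V) : baseEdges C ⊆ potentialEdges C := by
  intro S hS
  obtain ⟨T, hT, rfl⟩ := Finset.mem_image.1 hS
  obtain ⟨h1, h2⟩ := Finset.mem_powersetCard.1 hT
  rw [mem_potentialEdges, Finset.card_union_of_disjoint, h2, add_comm]
  exact Finset.disjoint_left.2 fun a ha hC => (Finset.mem_compl.1 (h1 ha)) hC

theorem mem_baseEdges_of_small {C S : Finset V} (hS : S ∈ potentialEdges C)
    (h : ¬ 3 ≤ (S \ C).card) : S ∈ baseEdges C := by
  rw [mem_potentialEdges] at hS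
  have h1 := Finset.card_sdiff_add_card_inter S C
  have h2 := Finset.card_le_card (Finset.inter_subset_right (s₁ := S) (s₂ := C))
  have h3 : S ∩ C = C := Finset.eq_of_subset_of_card_le Finset.inter_subset_right (by omega)
  refine Finset.mem_image.2 ⟨S \ C, Finset.mem_powersetCard.2 ⟨?_, by omega⟩, ?_⟩
  · intro a ha
    exact Finset.mem_compl.2 (Finset.mem_sdiff.1 ha).2
  · show S \ C ∪ C = S
    rw [Finset.sdiff_union_self_eq_union, Finset.union_eq_left]
    exact Finset.inter_eq_right.1 h3

/-- The expected number `x` of large hyperedges found is at most `p` times the expected number of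
large sets tested, which is at most `T` per hyperedge found. With `b` the mean number of base
hyperedges this gives `x ≤ pT(x + b)`, and `pT ≤ 1/2` allows solving for `x`. -/
theorem bernSum_large_le {p : ℝ} (h0 : 0 ≤ p) (h1 : p ≤ 1) (C : Finset V) (Δ D : ℕ)
    (hθ : p * (((C.card + 2) * (C.card + 2) * ((Δ + (C.card + 2)) *
      (C.card + (D + (C.card + 2))) ^ (C.card - 1)) : ℕ) : ℝ) ≤ 1 / 2) :
    bernSum p (potentialEdges C)
      (fun A => ({S ∈ (finalState C Δ D A).2 | 3 ≤ (S \ C).card}.card : ℝ)) ≤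
    2 * (p * (((C.card + 2) * (C.card + 2) * ((Δ + (C.card + 2)) *
      (C.card + (D + (C.card + 2))) ^ (C.card - 1)) : ℕ) : ℝ)) * (p * (baseEdges C).card) := by
  set L : Finset (Finset V) → ℝ := fun Y => ({S ∈ Y | 3 ≤ (S \ C).card}.card : ℝ) with hL
  set T : ℕ := (C.card + 2) * (C.card + 2) * ((Δ + (C.card + 2)) *
      (C.card + (D + (C.card + 2))) ^ (C.card - 1)) with hT
  -- Large sets found minus `p` times large sets tested is a martingale.
  have hmart : bernSum p (potentialEdges C)
      (fun A => L (finalState C Δ D A).2 + (-p) * L (finalState C Δ D A).1) ≤ 0 := by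
    refine (bernSum_exploreFinal_le h0 h1 nextTest_mem (fun s => L s.2 + (-p) * L s.1) ?_).trans ?_
    · intro R Y S hYR hS
      have hSR := (Finset.mem_sdiff.1 (nextTest_mem R Y S hS)).2
      have hSY : S ∉ Y := fun h => hSR (hYR h)
      have hins : ∀ Z : Finset (Finset V), S ∉ Z →
          L (insert S Z) = L Z + if 3 ≤ (S \ C).card then 1 else 0 := by
        intro Z hZ
        simp only [hL]
        rw [Finset.filter_insert]
        split_ifs with h
        · rw [Finset.card_insert_of_notMem (by simp [hZ])]
          push_cast; ring
        · simp
      simp only [hins R hSR, hins Y hSY]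
      apply le_of_eq
      ring
    · simp [hL]
  rw [bernSum_add, bernSum_const_mul] at hmart
  have hR : bernSum p (potentialEdges C) (fun A => L (finalState C Δ D A).1) ≤
      T * (bernSum p (potentialEdges C) (fun A => L (finalState C Δ D A).2) +
        p * (baseEdges C).card) := by
    have hb : bernSum p (potentialEdges C) (fun A => ((A ∩ baseEdges C).card : ℝ)) =
        p * (baseEdges C).card := by
      rw [bernSum_card_inter, Finset.inter_eq_right.2 (baseEdges_subset C)]
    rw [← hb, ← bernSum_add, ← bernSum_const_mul]
    refine bernSum_mono h0 h1 fun A _ => ?_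
    obtain ⟨s1, s2, s3, s4⟩ := finalState_spec C Δ D A
    set R := (finalState C Δ D A).1
    set Y := (finalState C Δ D A).2
    have hYU : Y ⊆ potentialEdges C := s1 ▸ Finset.inter_subset_right.trans s2
    have c1 := card_large_eligible_le s4 {S ∈ R | 3 ≤ (S \ C).card} (fun S hS => by
      obtain ⟨hS, hl⟩ := Finset.mem_filter.1 hS
      exact ⟨mem_potentialEdges.1 (s2 hS), s3 S hS, hl⟩) (Y.biUnion fun S => S ×ˢ S) (by
      rintro x y ⟨-, -, -, S, hS, hx, hy⟩
      exact Finset.mem_biUnion.2 ⟨S, hS, Finset.mem_product.2 ⟨hx, hy⟩⟩)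
    have c2 := card_biUnion_product_le fun S hS => mem_potentialEdges.1 (hYU hS)
    have c3 : Y.card ≤ {S ∈ Y | 3 ≤ (S \ C).card}.card + (A ∩ baseEdges C).card := by
      rw [← Finset.card_filter_add_card_filter_not (s := Y) (fun S => 3 ≤ (S \ C).card)]
      refine Nat.add_le_add_left (Finset.card_le_card fun S hS => ?_) _
      obtain ⟨hS, hl⟩ := Finset.mem_filter.1 hS
      refine Finset.mem_inter.2 ⟨?_, mem_baseEdges_of_small (hYU hS) hl⟩
      rw [s1] at hS
      exact (Finset.mem_inter.1 hS).1
    have c4 : {S ∈ R | 3 ≤ (S \ C).card}.card ≤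
        T * ({S ∈ Y | 3 ≤ (S \ C).card}.card + (A ∩ baseEdges C).card) := by
      refine c1.trans ?_
      calc _ ≤ Y.card * ((C.card + 2) * (C.card + 2)) * ((Δ + (C.card + 2)) *
            (C.card + (D + (C.card + 2))) ^ (C.card - 1)) := Nat.mul_le_mul_right _ c2
        _ = T * Y.card := by rw [hT]; ring
        _ ≤ _ := Nat.mul_le_mul_left _ c3
    simp only [hL]
    exact_mod_cast c4
  have hnn : 0 ≤ p * ((baseEdges C).card : ℝ) := by positivity
  have hLnn : 0 ≤ bernSum p (potentialEdges C) (fun A => L (finalState C Δ D A).2) := by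
    rw [← bernSum_const p 0 (potentialEdges C)]
    exact bernSum_mono h0 h1 fun A _ => by simp [hL]
  have hpR := mul_le_mul_of_nonneg_left hR h0
  set x := bernSum p (potentialEdges C) (fun A => L (finalState C Δ D A).2)
  set b := p * ((baseEdges C).card : ℝ)
  have h2 : x ≤ p * T * (x + b) := by linarith
  nlinarith

end Exploration

/-! ### Comparison of the process with the exploration. -/

open scoped Classical

/-- The vertices of the part of size `r - 2` of the initial graph. -/
def core (r n : ℕ) : Finset (Fin n) := {x | (x : ℕ) < r - 2}

theorem mem_core {r n : ℕ} {x : Fin n} : x ∈ core r n ↔ (x : ℕ) < r - 2 := by simp [core]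

theorem card_core {r n : ℕ} (h : r - 2 ≤ n) : (core r n).card = r - 2 := by
  rw [core, Fin.card_filter_val_lt, min_eq_right h]

theorem startGraph_adj {r n : ℕ} {x y : Fin n} :
    (startGraph r n).Adj x y ↔ ¬ (x ∈ core r n ↔ y ∈ core r n) := by
  simp [startGraph, mem_core]

theorem startGraph_le_process {r n : ℕ} (H : Set (Finset (Fin n))) (c : ℕ → Fin n × Fin n)
    (t : ℕ) : startGraph r n ≤ process r H c t := by
  induction t with
  | zero => exact le_rfl
  | succ t ih =>
    refine ih.trans ?_
    rw [process, step]
    split_ifs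
    · exact le_sup_left
    · exact le_rfl

/-- The hyperedges in `H`. -/
noncomputable def hyperedges (r : ℕ) {n : ℕ} (H : Set (Finset (Fin n))) :
    Finset (Finset (Fin n)) := {S ∈ potentialEdges (core r n) | S ∈ H}

theorem mem_hyperedges {r n : ℕ} {H : Set (Finset (Fin n))} {S : Finset (Fin n)} :
    S ∈ hyperedges r H ↔ S ∈ potentialEdges (core r n) ∧ S ∈ H := by simp [hyperedges]

/-- If the final bounds hold, the exploration stopped only for lack of untested eligible sets, so
its graph is closed under the rule of the process. Induction on time then works for every sequence
of choices. -/
theorem process_adj_outer {r n : ℕ} (hn : r - 2 ≤ n) {H : Set (Finset (Fin n))}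
    (c : ℕ → Fin n × Fin n) {Δ D : ℕ}
    (hb : DegBounded Δ D (outerGraph (core r n)
      (finalState (core r n) Δ D (hyperedges r H)).2)) (t : ℕ) :
    ∀ x y, x ∉ core r n → y ∉ core r n → (process r H c t).Adj x y →
      (outerGraph (core r n) (finalState (core r n) Δ D (hyperedges r H)).2).Adj x y := by
  induction t with
  | zero =>
    intro x y hx hy h
    exact absurd (iff_of_false hx hy) (startGraph_adj.1 h)
  | succ t ih =>
    have key : ∀ x y, x ≠ y → x ∉ core r n → y ∉ core r n → CanAdd r H (process r H c t) x y →
        (outerGraph (core r n) (finalState (core r n) Δ D (hyperedges r H)).2).Adj x y := by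
      rintro x y hxy hx hy ⟨Z, hZ, hadj, hH⟩
      have hxZ : x ∉ Z := fun h => (hadj x h).1.ne rfl
      have hyZ : y ∉ Z := fun h => (hadj y h).2.ne rfl
      have hcard : (insert x (insert y Z)).card = (core r n).card + 2 := by
        rw [Finset.card_insert_of_notMem (by simp [hxy, hxZ]), Finset.card_insert_of_notMem hyZ,
          hZ, card_core hn]
      have hU := mem_potentialEdges.2 hcard
      obtain ⟨s1, -, -, -⟩ := finalState_spec (core r n) Δ D (hyperedges r H)
      have hel : Eligible (core r n)
          (outerGraph (core r n) (finalState (core r n) Δ D (hyperedges r H)).2)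
          (insert x (insert y Z)) := by
        refine ⟨x, y, by simp, by simp, hxy, hx, hy, fun z hz hzC hzx hzy => ?_⟩
        have hzZ : z ∈ Z := by simpa [hzx, hzy] using hz
        exact ⟨(ih x z hx hzC (hadj z hzZ).1).symm, (ih y z hy hzC (hadj z hzZ).2).symm⟩
      have hR := nextTest_eq_none (exploreFinal_stops (hyperedges r H) nextTest_mem) hb hU hel
      refine ⟨hxy, hx, hy, insert x (insert y Z), ?_, by simp, by simp⟩
      rw [s1]
      exact Finset.mem_inter.2 ⟨mem_hyperedges.2 ⟨hU, hH⟩, hR⟩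
    intro x y hx hy h
    rw [process, step] at h
    split_ifs at h with hadd
    · rcases h with h | h
      · exact ih x y hx hy h
      · rw [SimpleGraph.edge_adj] at h
        obtain ⟨⟨rfl, rfl⟩ | ⟨rfl, rfl⟩, hne⟩ := h
        · exact key _ _ hne hx hy hadd
        · exact (key _ _ hne.symm hy hx hadd).symm
    · exact ih x y hx hy h

/-- The first `r ^ 2` covers added edges inside the core. Every other added edge lies in a hyperedge
found: a base hyperedge has one pair outside the core, a larger one at most `r ^ 2`. -/
theorem addedEdges_le {r n : ℕ} (hr : 2 ≤ r) (hn : r - 2 ≤ n) {H : Set (Finset (Fin n))}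
    (c : ℕ → Fin n × Fin n) {Δ D : ℕ}
    (hb : DegBounded Δ D (outerGraph (core r n)
      (finalState (core r n) Δ D (hyperedges r H)).2)) :
    addedEdges r H c ≤ r ^ 2 + ((hyperedges r H ∩ baseEdges (core r n)).card +
      r ^ 2 * {S ∈ (finalState (core r n) Δ D (hyperedges r H)).2 |
        3 ≤ (S \ core r n).card}.card) := by
  set C := core r n
  obtain ⟨s1, s2, -, -⟩ := finalState_spec C Δ D (hyperedges r H)
  set Y := (finalState C Δ D (hyperedges r H)).2
  have hYU : ∀ S ∈ Y, S ∈ potentialEdges C := fun S hS =>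
    s2 (Finset.mem_inter.1 (s1 ▸ hS)).2
  have hC : C.card + 2 = r := by rw [card_core hn]; omega
  have hsub : ((finalGraph r H c).edgeSet \ (startGraph r n).edgeSet) ⊆
      (((C ×ˢ C).image Sym2.mk.uncurry ∪
        Y.biUnion fun S => (S \ C).offDiag.image Sym2.mk.uncurry : Finset (Sym2 (Fin n))) :
        Set (Sym2 (Fin n))) := by
    intro e
    induction e using Sym2.ind with
    | _ x y =>
    rintro ⟨h1, h2⟩
    rw [SimpleGraph.mem_edgeSet] at h1 h2
    rw [finalGraph, SimpleGraph.iSup_adj] at h1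
    obtain ⟨t, ht⟩ := h1
    rw [startGraph_adj, not_not] at h2
    rw [Finset.mem_coe, Finset.mem_union]
    by_cases hx : x ∈ C
    · left
      exact Finset.mem_image.2 ⟨(x, y), Finset.mem_product.2 ⟨hx, h2.1 hx⟩, rfl⟩
    · right
      have hy : y ∉ C := fun h => hx (h2.2 h)
      obtain ⟨hxy, -, -, S, hS, hxS, hyS⟩ := process_adj_outer hn c hb t x y hx hy ht
      exact Finset.mem_biUnion.2 ⟨S, hS, Finset.mem_image.2 ⟨(x, y), Finset.mem_offDiag.2
        ⟨Finset.mem_sdiff.2 ⟨hxS, hx⟩, Finset.mem_sdiff.2 ⟨hyS, hy⟩, hxy⟩, rfl⟩⟩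
  rw [addedEdges]
  refine (Set.ncard_le_ncard hsub (Finset.finite_toSet _)).trans ?_
  rw [Set.ncard_coe_finset]
  refine card_union_le_of_le ?_ ?_
  · refine Finset.card_image_le.trans ?_
    rw [Finset.card_product, ← sq]
    exact Nat.pow_le_pow_left (by omega) 2
  · refine Finset.card_biUnion_le.trans ?_
    simp only [Sym2.card_image_offDiag]
    rw [← Finset.sum_filter_add_sum_filter_not Y (fun S => 3 ≤ (S \ C).card), add_comm]
    refine add_le_add ?_ ?_
    · calc ∑ S ∈ Y with ¬3 ≤ (S \ C).card, (S \ C).card.choose 2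
          ≤ ∑ S ∈ Y with ¬3 ≤ (S \ C).card, 1 := by
            refine Finset.sum_le_sum fun S hS => ?_
            have := (Finset.mem_filter.1 hS).2
            interval_cases (S \ C).card <;> simp
        _ = {S ∈ Y | ¬3 ≤ (S \ C).card}.card := by simp
        _ ≤ _ := by
            refine Finset.card_le_card fun S hS => ?_
            obtain ⟨hS, hl⟩ := Finset.mem_filter.1 hS
            exact Finset.mem_inter.2 ⟨(Finset.mem_inter.1 (s1 ▸ hS)).1,
              mem_baseEdges_of_small (hYU S hS) hl⟩
    · refine (Finset.sum_le_card_nsmul _ _ (r ^ 2) fun S hS => ?_).trans ?_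
      · have := mem_potentialEdges.1 (hYU S (Finset.mem_filter.1 hS).1)
        refine (Nat.choose_le_pow _ _).trans (Nat.pow_le_pow_left ?_ 2)
        exact (Finset.card_le_card Finset.sdiff_subset).trans (by omega)
      · rw [smul_eq_mul, mul_comm]

/-- For a base hyperedge the core itself serves as `Z` at every time, so its outer pair is added as
soon as it is chosen. -/
theorem card_le_addedEdges {r n : ℕ} (hn : r - 2 ≤ n) {H : Set (Finset (Fin n))}
    {c : ℕ → Fin n × Fin n} (hc : ∀ q : Fin n × Fin n, q.1 ≠ q.2 → ∃ t, c t = q) :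
    (hyperedges r H ∩ baseEdges (core r n)).card ≤ addedEdges r H c := by
  have hsub : ((hyperedges r H ∩ baseEdges (core r n) : Finset (Finset (Fin n))) :
      Set (Finset (Fin n))) ⊆ (fun e : Sym2 (Fin n) => e.toFinset ∪ core r n) ''
        ((finalGraph r H c).edgeSet \ (startGraph r n).edgeSet) := by
    intro S hS
    obtain ⟨hS1, hS2⟩ := Finset.mem_inter.1 hS
    obtain ⟨hSU, hSH⟩ := mem_hyperedges.1 hS1
    obtain ⟨T, hT, rfl⟩ := Finset.mem_image.1 hS2
    obtain ⟨hTC, hT2⟩ := Finset.mem_powersetCard.1 hT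
    obtain ⟨x, y, hxy, rfl⟩ := Finset.card_eq_two.1 hT2
    have hx : x ∉ core r n := Finset.mem_compl.1 (hTC (by simp))
    have hy : y ∉ core r n := Finset.mem_compl.1 (hTC (by simp))
    refine ⟨s(x, y), ⟨?_, ?_⟩, by simp [Sym2.toFinset_mk_eq]⟩
    · obtain ⟨t, ht⟩ := hc (x, y) hxy
      rw [SimpleGraph.mem_edgeSet, finalGraph, SimpleGraph.iSup_adj]
      refine ⟨t + 1, ?_⟩
      have hadd : CanAdd r H (process r H c t) x y := by
        refine ⟨core r n, card_core hn, fun z hz => ⟨?_, ?_⟩, ?_⟩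
        · exact startGraph_le_process H c t (startGraph_adj.2 (by simp [hx, hz]))
        · exact startGraph_le_process H c t (startGraph_adj.2 (by simp [hy, hz]))
        · simpa [Finset.insert_union] using hSH
      rw [process, step, ht, if_pos hadd]
      right
      rw [SimpleGraph.edge_adj]
      exact ⟨Or.inl ⟨rfl, rfl⟩, hxy⟩
    · rw [SimpleGraph.mem_edgeSet, startGraph_adj, not_not]
      exact iff_of_false hx hy
  rw [addedEdges, ← Set.ncard_coe_finset]
  exact (Set.ncard_le_ncard hsub (Set.toFinite _)).trans (Set.ncard_image_le (Set.toFinite _))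

/-! ### The probability space, and the bound for fixed `n`. -/

theorem isProbabilityMeasure_uniformOn_pairs {n : ℕ} (hn : 2 ≤ n) :
    IsProbabilityMeasure (uniformOn {q : Fin n × Fin n | q.1 ≠ q.2}) :=
  isProbabilityMeasure_uniformOn (Set.toFinite _)
    ⟨(⟨0, by omega⟩, ⟨1, by omega⟩), by simp⟩

theorem randomChoices_all_pairs {n : ℕ} (hn : 2 ≤ n) :
    randomChoices n {c | ∀ q : Fin n × Fin n, q.1 ≠ q.2 → ∃ t, c t = q} = 1 := by
  have := isProbabilityMeasure_uniformOn_pairs hn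
  have hP : IsProbabilityMeasure (randomChoices n) := by
    unfold randomChoices; infer_instance
  have hae : ∀ᵐ c ∂(randomChoices n), ∀ q : Fin n × Fin n, q.1 ≠ q.2 → ∃ t, c t = q := by
    rw [ae_all_iff]
    intro q
    by_cases hq : q.1 ≠ q.2
    swap
    · exact Eventually.of_forall fun _ h => absurd h hq
    rw [ae_iff]
    set μ := uniformOn {q : Fin n × Fin n | q.1 ≠ q.2} with hμ
    have hlt : μ {q}ᶜ < 1 := by
      rw [prob_compl_eq_one_sub (measurableSet_singleton q)]
      refine ENNReal.sub_lt_self ENNReal.one_ne_top one_ne_zero ?_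
      rw [hμ, Ne, uniformOn_eq_zero_iff (Set.toFinite _)]
      intro h
      have : q ∈ ({q : Fin n × Fin n | q.1 ≠ q.2} ∩ {q} : Set _) := ⟨hq, rfl⟩
      rw [h] at this
      exact this
    -- Never choosing `q` entails missing it in the first `k` independent steps.
    have hle : ∀ k : ℕ, randomChoices n {c | ¬ (q.1 ≠ q.2 → ∃ t, c t = q)} ≤ (μ {q}ᶜ) ^ k := by
      intro k
      have h1 : {c : ℕ → Fin n × Fin n | ¬ (q.1 ≠ q.2 → ∃ t, c t = q)} ⊆
          Set.pi (Finset.range k) fun _ => {q}ᶜ := by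
        intro c hc t _
        simp only [Set.mem_ofPred_eq, not_forall, not_exists] at hc
        exact hc.2 t
      refine (measure_mono h1).trans ?_
      rw [randomChoices, Measure.infinitePi_pi _ (fun _ _ => (measurableSet_singleton q).compl)]
      simp [hμ]
    have hlim := ENNReal.tendsto_pow_atTop_nhds_zero_of_lt_one hlt
    exact le_antisymm (ge_of_tendsto' hlim hle) zero_le
  exact (prob_compl_eq_zero_iff₀ (by
    exact NullMeasurableSet.of_compl (NullMeasurableSet.of_null (ae_iff.1 hae)))).1 (ae_iff.1 hae)

/-- The random hypergraph almost surely consists of `r`-sets, so the event reduces to finitely many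
atoms of explicit mass. -/
theorem randomHypergraph_real_eq_bernSum {r n : ℕ} (hr : 2 ≤ r) (hn : r - 2 ≤ n) (p : unitInterval)
    (P : Finset (Finset (Fin n)) → Prop) [DecidablePred P] :
    (randomHypergraph r n p).real {H | P (hyperedges r H)} =
      bernSum (p : ℝ) (potentialEdges (core r n)) (fun A => if P A then 1 else 0) := by
  set U := potentialEdges (core r n)
  have hu : {e : Finset (Fin n) | e.card = r} = (U : Set (Finset (Fin n))) := by
    ext S
    have : (core r n).card + 2 = r := by rw [card_core hn]; omega
    simp [U, mem_potentialEdges, this]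
  have hA : ∀ A ⊆ U, hyperedges r (A : Set (Finset (Fin n))) = A := by
    intro A hA
    ext S
    rw [mem_hyperedges]
    exact ⟨fun h => h.2, fun h => ⟨hA h, h⟩⟩
  have hset : {H : Set (Finset (Fin n)) | H ∈ {H | P (hyperedges r H)} ∧ H ⊆ (U : Set _)} =
      ⋃ A ∈ {A ∈ U.powerset | P A}, {(A : Set (Finset (Fin n)))} := by
    ext H
    simp only [Set.mem_ofPred_eq, Finset.mem_filter, Finset.mem_powerset, Set.mem_iUnion,
      Set.mem_singleton_iff, exists_prop]
    constructor
    · rintro ⟨h1, h2⟩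
      have : ((hyperedges r H : Finset _) : Set (Finset (Fin n))) = H := by
        ext S
        rw [Finset.mem_coe, mem_hyperedges]
        exact ⟨fun h => h.2, fun h => ⟨h2 h, h⟩⟩
      exact ⟨hyperedges r H, ⟨Finset.filter_subset _ _, h1⟩, this.symm⟩
    · rintro ⟨A, ⟨h1, h2⟩, rfl⟩
      exact ⟨by rwa [hA A h1], by exact_mod_cast h1⟩
  rw [randomHypergraph, hu, measureReal_def, setBernoulli_apply_eq_apply_subsets, hset,
    ← measureReal_def, measureReal_biUnion_finset]
  · rw [bernSum, Finset.sum_filter]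
    refine Finset.sum_congr rfl fun A hA => ?_
    have hAU : (A : Set (Finset (Fin n))) ⊆ U := by exact_mod_cast Finset.mem_powerset.1 hA
    rw [setBernoulli_real_singleton p hAU (Finset.finite_toSet _), Set.ncard_coe_finset,
      ← Finset.coe_sdiff, Set.ncard_coe_finset]
    split_ifs <;> simp
  · intro A _ B _ hAB
    simpa [Function.onFun] using hAB
  · exact fun A _ => measurableSet_singleton _

/-- A bound for the number of ways to complete a path of length two to an eligible set. -/
def completions (r D : ℕ) : ℕ := (r - 2 + (D + r)) ^ (r - 3)

theorem bernSum_good_ge {r n : ℕ} (hr : 3 ≤ r) (hn : r - 2 ≤ n) {p : ℝ} (h0 : 0 ≤ p) (h1 : p ≤ 1)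
    {Δ D : ℕ} (hDΔ : D ≤ Δ)
    (hθ : p * ((r * r * ((Δ + r) * completions r D) : ℕ) : ℝ) ≤ 1 / 2) {a : ℝ} (ha : 0 < a) :
    1 - (n * Real.exp (2 * p * ((n + 2 * ((Δ + r) * ((Δ + r) * completions r D)) : ℕ) : ℝ) - Δ / r)
      + (n : ℝ) ^ 2 * Real.exp (2 * p * ((19 * ((Δ + r) * (D + r) * completions r D) : ℕ) : ℝ)
        - D / r)
      + p * (n - (r - 2)).choose 2 / a ^ 2
      + r ^ 2 * (2 * (p * ((r * r * ((Δ + r) * completions r D) : ℕ) : ℝ)) *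
        (p * (n - (r - 2)).choose 2)) / a) ≤
    bernSum p (potentialEdges (core r n)) (fun A =>
      if DegBounded Δ D (outerGraph (core r n) (finalState (core r n) Δ D A).2) ∧
        |((A ∩ baseEdges (core r n)).card : ℝ) - p * (n - (r - 2)).choose 2| ≤ a ∧
        ((r ^ 2 * {S ∈ (finalState (core r n) Δ D A).2 | 3 ≤ (S \ core r n).card}.card : ℕ) : ℝ)
          ≤ a then 1 else 0) := by
  have hC : (core r n).card = r - 2 := card_core hn
  have hC2 : (core r n).card + 2 = r := by omega
  have hC1 : (core r n).card - 1 = r - 3 := by omega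
  have e1 := bernSum_not_degBounded_le h0 h1 (C := core r n) (by omega) hDΔ
  have e2 := bernSum_variance p (potentialEdges (core r n)) (baseEdges (core r n))
  have e3 := bernSum_large_le h0 h1 (core r n) Δ D
  rw [Finset.inter_eq_right.2 (baseEdges_subset _)] at e2
  rw [hC2, hC1, card_baseEdges] at e3
  rw [hC2, hC1] at e1
  rw [card_baseEdges] at e2
  rw [hC, Fintype.card_fin] at e1 e2 e3
  simp only [completions] at hθ ⊢
  replace e3 := e3 hθ
  set U := potentialEdges (core r n)
  set m := (n - (r - 2)).choose 2
  set f1 : Finset (Finset (Fin n)) → ℝ := fun A =>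
    if DegBounded Δ D (outerGraph (core r n) (finalState (core r n) Δ D A).2) then 0 else 1
  set f2 : Finset (Finset (Fin n)) → ℝ := fun A =>
    (((A ∩ baseEdges (core r n)).card : ℝ) - p * m) ^ 2
  set f3 : Finset (Finset (Fin n)) → ℝ := fun A =>
    ({S ∈ (finalState (core r n) Δ D A).2 | 3 ≤ (S \ core r n).card}.card : ℝ)
  -- The union bound, Chebyshev's and Markov's inequalities in one pointwise comparison: if the good
  -- event fails, one of the three penalties is at least `1`.
  have hlow : bernSum p U (fun A => 1 + (((-1) * f1 A + (-(1 / a ^ 2)) * f2 A) +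
      (-(r ^ 2 / a)) * f3 A)) ≤ bernSum p U (fun A =>
      if DegBounded Δ D (outerGraph (core r n) (finalState (core r n) Δ D A).2) ∧
        |((A ∩ baseEdges (core r n)).card : ℝ) - p * m| ≤ a ∧
        ((r ^ 2 * {S ∈ (finalState (core r n) Δ D A).2 | 3 ≤ (S \ core r n).card}.card : ℕ) : ℝ)
          ≤ a then 1 else 0) := by
    refine bernSum_mono h0 h1 fun A _ => ?_
    have n1 : 0 ≤ f1 A := by simp only [f1]; split_ifs <;> simp
    have n2 : 0 ≤ 1 / a ^ 2 * f2 A := by positivity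
    have n3 : 0 ≤ r ^ 2 / a * f3 A := by positivity
    split_ifs with h
    · linarith
    · suffices 1 ≤ f1 A ∨ 1 ≤ 1 / a ^ 2 * f2 A ∨ 1 ≤ r ^ 2 / a * f3 A by
        rcases this with h | h | h <;> linarith
      by_cases g1 : DegBounded Δ D (outerGraph (core r n) (finalState (core r n) Δ D A).2)
      · right
        by_cases g2 : |((A ∩ baseEdges (core r n)).card : ℝ) - p * m| ≤ a
        · right
          have g3 : ¬ ((r ^ 2 * {S ∈ (finalState (core r n) Δ D A).2 |
              3 ≤ (S \ core r n).card}.card : ℕ) : ℝ) ≤ a := fun g3 => h ⟨g1, g2, g3⟩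
          push_cast at g3
          rw [div_mul_eq_mul_div, one_le_div ha]
          exact (not_le.1 g3).le
        · left
          rw [one_div, inv_mul_eq_div, one_le_div (by positivity)]
          simp only [f2]
          rw [← sq_abs (((A ∩ baseEdges (core r n)).card : ℝ) - p * m)]
          exact pow_le_pow_left₀ ha.le (not_le.1 g2).le 2
      · left
        simp [f1, g1]
  refine le_trans ?_ hlow
  rw [bernSum_add, bernSum_add, bernSum_add, bernSum_const, bernSum_const_mul, bernSum_const_mul,
    bernSum_const_mul, e2]
  have b2 : 1 / a ^ 2 * (p * (1 - p) * m) ≤ p * m / a ^ 2 := by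
    rw [one_div, inv_mul_eq_div]
    gcongr
    nlinarith
  have b3 : r ^ 2 / a * bernSum p U f3 ≤ r ^ 2 * (2 * (p * ((r * r * ((Δ + r) *
      (r - 2 + (D + r)) ^ (r - 3)) : ℕ) : ℝ)) * (p * m)) / a := by
    rw [div_mul_eq_mul_div]
    gcongr
  linarith

/-- The error `εμ` is split into four quarters: edges inside the core, fluctuation of the base
hyperedges, edges from large hyperedges, and the gap between the exact mean and `μ`. -/
theorem triadicMeasure_ge {r n : ℕ} (hr : 3 ≤ r) (hn : r - 2 ≤ n) (hn2 : 2 ≤ n) (p : unitInterval)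
    {Δ D : ℕ} (hDΔ : D ≤ Δ)
    (hθ : (p : ℝ) * ((r * r * ((Δ + r) * completions r D) : ℕ) : ℝ) ≤ 1 / 2) {ε μ : ℝ}
    (hε : 0 < ε) (hμ : 0 < μ) (hrμ : (r : ℝ) ^ 2 ≤ ε / 4 * μ)
    (hm : |(p : ℝ) * (n - (r - 2)).choose 2 - μ| ≤ ε / 4 * μ)
    (hm' : (p : ℝ) * (n - (r - 2)).choose 2 ≤ μ) :
    ENNReal.ofReal (1 - (n * Real.exp (2 * p *
        ((n + 2 * ((Δ + r) * ((Δ + r) * completions r D)) : ℕ) : ℝ) - Δ / r)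
      + (n : ℝ) ^ 2 * Real.exp (2 * p * ((19 * ((Δ + r) * (D + r) * completions r D) : ℕ) : ℝ)
        - D / r)
      + 16 / ε ^ 2 * (1 / μ)
      + 8 * r ^ 2 / ε * (p * ((r * r * ((Δ + r) * completions r D) : ℕ) : ℝ)))) ≤
    triadicMeasure r n p {ω | |(addedEdges r ω.1 ω.2 : ℝ) - μ| ≤ ε * μ} := by
  have h0 : (0 : ℝ) ≤ p := p.2.1
  have h1 : (p : ℝ) ≤ 1 := p.2.2
  have ha : 0 < ε / 4 * μ := by positivity
  set θ := (p : ℝ) * ((r * r * ((Δ + r) * completions r D) : ℕ) : ℝ)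
  have hθ0 : 0 ≤ θ := by positivity
  have hge := bernSum_good_ge hr hn h0 h1 hDΔ hθ ha
  rw [← randomHypergraph_real_eq_bernSum (by omega) hn p] at hge
  set good : Set (Set (Finset (Fin n))) := {H |
    DegBounded Δ D (outerGraph (core r n) (finalState (core r n) Δ D (hyperedges r H)).2) ∧
        |((hyperedges r H ∩ baseEdges (core r n)).card : ℝ) - p * (n - (r - 2)).choose 2|
          ≤ ε / 4 * μ ∧
        ((r ^ 2 * {S ∈ (finalState (core r n) Δ D (hyperedges r H)).2 |
          3 ≤ (S \ core r n).card}.card : ℕ) : ℝ) ≤ ε / 4 * μ} with hgood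
  set pairs : Set (ℕ → Fin n × Fin n) := {c | ∀ q : Fin n × Fin n, q.1 ≠ q.2 → ∃ t, c t = q}
  have hsub : good ×ˢ pairs ⊆ {ω | |(addedEdges r ω.1 ω.2 : ℝ) - μ| ≤ ε * μ} := by
    rintro ⟨H, c⟩ ⟨⟨g1, g2, g3⟩, hc⟩
    have u1 := addedEdges_le (by omega : 2 ≤ r) hn c g1
    have u2 := card_le_addedEdges hn hc (H := H)
    have u1' : (addedEdges r H c : ℝ) ≤ (r : ℝ) ^ 2 +
        (((hyperedges r H ∩ baseEdges (core r n)).card : ℝ) +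
          ((r ^ 2 * {S ∈ (finalState (core r n) Δ D (hyperedges r H)).2 |
          3 ≤ (S \ core r n).card}.card : ℕ) : ℝ)) := by exact_mod_cast u1
    have u2' : ((hyperedges r H ∩ baseEdges (core r n)).card : ℝ) ≤ addedEdges r H c := by
      exact_mod_cast u2
    rw [abs_le] at g2 hm
    show |(addedEdges r H c : ℝ) - μ| ≤ ε * μ
    rw [abs_le]
    constructor <;> linarith
  have := isProbabilityMeasure_uniformOn_pairs hn2
  have hP : IsProbabilityMeasure (randomChoices n) := by
    unfold randomChoices; infer_instance
  have hP' : IsProbabilityMeasure (randomHypergraph r n p) := by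
    unfold randomHypergraph; infer_instance
  calc _ ≤ ENNReal.ofReal ((randomHypergraph r n p).real good) := by
        refine ENNReal.ofReal_le_ofReal (le_trans ?_ hge)
        have i1 : (p : ℝ) * (n - (r - 2)).choose 2 / (ε / 4 * μ) ^ 2 ≤ 16 / ε ^ 2 * (1 / μ) := by
          rw [div_le_iff₀ (by positivity)]
          refine hm'.trans (le_of_eq ?_)
          field_simp
          norm_num
        have i2 : r ^ 2 * (2 * θ * (p * (n - (r - 2)).choose 2)) / (ε / 4 * μ) ≤
            8 * r ^ 2 / ε * θ := by
          rw [div_le_iff₀ ha]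
          calc (r : ℝ) ^ 2 * (2 * θ * (p * (n - (r - 2)).choose 2)) ≤ r ^ 2 * (2 * θ * μ) := by
                gcongr
            _ = _ := by field_simp; ring
        linarith
    _ = randomHypergraph r n p good := ofReal_measureReal
    _ = triadicMeasure r n p (good ×ˢ pairs) := by
        rw [triadicMeasure, Measure.prod_prod, randomChoices_all_pairs hn2, mul_one]
    _ ≤ _ := measure_mono hsub

/-! ### Asymptotics. -/

theorem tendsto_log_natCast : Tendsto (fun n : ℕ => Real.log n) atTop atTop :=
  Real.tendsto_log_atTop.comp tendsto_natCast_atTop_atTop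

theorem tendsto_rpow_mul_log_rpow (β : ℝ) :
    Tendsto (fun n : ℕ => (n : ℝ) ^ (-(1 / 2) : ℝ) * Real.log n ^ β) atTop (𝓝 0) := by
  have h := (isLittleO_log_rpow_rpow_atTop β (show (0 : ℝ) < 1 / 2 by norm_num)).tendsto_div_nhds_zero
  refine (h.comp tendsto_natCast_atTop_atTop).congr fun n => ?_
  simp only [Function.comp]
  rw [Real.rpow_neg (Nat.cast_nonneg n), div_eq_inv_mul]

/-- Used with `β = 2α`: this is where `α > 1/2` beats the factor `n²` of the union bound. -/
theorem tendsto_exp_sub_rpow {β a : ℝ} (hβ : 1 < β) (ha : 0 < a) :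
    Tendsto (fun n : ℕ => Real.exp (2 * Real.log n - a * Real.log n ^ β)) atTop (𝓝 0) := by
  refine Real.tendsto_exp_atBot.comp ?_
  have h1 : Tendsto (fun x : ℝ => x * (2 - a * x ^ (β - 1))) atTop atBot := by
    refine Tendsto.atTop_mul_atBot₀ tendsto_id ?_
    have := (tendsto_rpow_atTop (show 0 < β - 1 by linarith)).const_mul_atTop ha
    exact tendsto_atBot_add_const_left _ 2 (tendsto_neg_atTop_atBot.comp this)
  refine (h1.comp tendsto_log_natCast).congr' ?_
  filter_upwards [tendsto_log_natCast.eventually_gt_atTop 0] with n hn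
  simp only [Function.comp]
  have : Real.log n ^ β = Real.log n * Real.log n ^ (β - 1) := by
    rw [← Real.rpow_one_add' hn.le (by linarith)]
    congr 1; ring
  rw [this]; ring

/-- The codegree bound of the exploration. -/
noncomputable def codegBound (α : ℝ) (n : ℕ) : ℕ := ⌈Real.log n ^ (2 * α)⌉₊

/-- The degree bound of the exploration. -/
noncomputable def degBound (r : ℕ) (α p : ℝ) (n : ℕ) : ℕ := codegBound α n + ⌈8 * r * n * p⌉₊

/-- Write `L = (log n)^(2α)` and `k = r - 3`. Up to constants the quantity is at most `p * L ^ (k +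
1) + n * p² * L ^ k`. The bound `g` on `p` satisfies `n * g² * L ^ k = 1`, so the second term is `(p
/ g)²`, while the first has a factor `n^(-1/2)` to spare. -/
theorem tendsto_degBound_mul_completions {r : ℕ} (hr : 3 ≤ r) {α : ℝ} (hα : 0 < α)
    {p : ℕ → ℝ} (hp0 : ∀ n, 0 ≤ p n)
    (hp : p =o[atTop] fun n : ℕ => (n : ℝ) ^ (-(1 / 2) : ℝ) * Real.log n ^ (α * (3 - (r : ℝ)))) :
    Tendsto (fun n => p n * (((degBound r α (p n) n + r) *
      completions r (codegBound α n) : ℕ) : ℝ)) atTop (𝓝 0) := by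
  obtain ⟨k, rfl⟩ := Nat.exists_eq_add_of_le' hr
  set g : ℕ → ℝ := fun n => (n : ℝ) ^ (-(1 / 2) : ℝ) * Real.log n ^ (α * (3 - ((k + 3 : ℕ) : ℝ)))
    with hg
  have hx : Tendsto (fun n => p n / g n) atTop (𝓝 0) := hp.tendsto_div_nhds_zero
  have hy := tendsto_rpow_mul_log_rpow (α * (k + 2))
  have hlim : Tendsto (fun n : ℕ => 4 ^ k * (4 * (p n / g n * ((n : ℝ) ^ (-(1 / 2) : ℝ) *
      Real.log n ^ (α * (k + 2)))) + 8 * (k + 3 : ℕ) * (p n / g n) ^ 2)) atTop (𝓝 0) := by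
    have := (((hx.mul hy).const_mul 4).add ((hx.pow 2).const_mul (8 * ((k + 3 : ℕ) : ℝ)))).const_mul
      (4 ^ k : ℝ)
    simpa using this
  refine tendsto_of_tendsto_of_tendsto_of_le_of_le' tendsto_const_nhds hlim
    (Eventually.of_forall fun n => mul_nonneg (hp0 n) (Nat.cast_nonneg _)) ?_
  have hL : Tendsto (fun n : ℕ => Real.log n ^ (2 * α)) atTop atTop :=
    (tendsto_rpow_atTop (by positivity)).comp tendsto_log_natCast
  -- Once `L ≥ k + 3`, all additive constants, including those from rounding up, are absorbed in `4
  -- * L`.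
  filter_upwards [tendsto_log_natCast.eventually_gt_atTop 0, eventually_gt_atTop 0,
    hL.eventually_ge_atTop ((k + 3 : ℕ) : ℝ)] with n hlog hn hLn
  have hn' : (0 : ℝ) < n := by exact_mod_cast hn
  set L := Real.log n ^ (2 * α) with hLdef
  have hgpos : 0 < g n := by positivity
  have hpx : p n = p n / g n * g n := by field_simp
  have hgL : g n * L ^ (k + 1) = (n : ℝ) ^ (-(1 / 2) : ℝ) * Real.log n ^ (α * (k + 2)) := by
    simp only [hg, hLdef]
    rw [← Real.rpow_natCast, ← Real.rpow_mul hlog.le, mul_assoc, ← Real.rpow_add hlog]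
    congr 2
    push_cast; ring
  have hg2 : n * g n ^ 2 * L ^ k = 1 := by
    simp only [hg, hLdef]
    rw [← Real.rpow_natCast (Real.log n ^ (2 * α)), ← Real.rpow_mul hlog.le, mul_pow,
      ← Real.rpow_natCast, ← Real.rpow_natCast, ← Real.rpow_mul hlog.le, ← Real.rpow_mul hn'.le,
      ← mul_assoc, mul_assoc, ← Real.rpow_add hlog]
    have e1 : (n : ℝ) * (n : ℝ) ^ (-(1 / 2) * ((2 : ℕ) : ℝ)) = 1 := by
      rw [show (-(1 / 2) * ((2 : ℕ) : ℝ)) = -1 by norm_num, Real.rpow_neg_one]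
      field_simp
    rw [e1, show α * (3 - ((k + 3 : ℕ) : ℝ)) * ((2 : ℕ) : ℝ) + 2 * α * (k : ℝ) = 0 by
      push_cast; ring, Real.rpow_zero, one_mul]
  have hk : (3 : ℝ) ≤ (k + 3 : ℕ) := by push_cast; linarith [(Nat.cast_nonneg k : (0 : ℝ) ≤ k)]
  have hD : (codegBound α n : ℝ) ≤ L + 1 := (Nat.ceil_lt_add_one (by positivity)).le
  have hc : (⌈8 * ((k + 3 : ℕ) : ℝ) * n * p n⌉₊ : ℝ) ≤ 8 * (k + 3 : ℕ) * n * p n + 1 :=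
    (Nat.ceil_lt_add_one (by have := hp0 n; positivity)).le
  have hΔ : ((degBound (k + 3) α (p n) n : ℕ) : ℝ) + (k + 3 : ℕ) ≤
      4 * L + 8 * (k + 3 : ℕ) * n * p n := by
    rw [degBound]
    push_cast at *
    linarith
  have hK : (completions (k + 3) (codegBound α n) : ℝ) ≤ (4 * L) ^ k := by
    have : completions (k + 3) (codegBound α n) = (k + 1 + (codegBound α n + (k + 3))) ^ k := by
      rw [completions]; rfl
    rw [this]
    push_cast at *
    gcongr
    linarith
  calc p n * (((degBound (k + 3) α (p n) n + (k + 3)) *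
        completions (k + 3) (codegBound α n) : ℕ) : ℝ)
      ≤ p n * ((4 * L + 8 * (k + 3 : ℕ) * n * p n) * (4 * L) ^ k) := by
        have := hp0 n
        rw [Nat.cast_mul, Nat.cast_add]
        gcongr
    _ = 4 ^ k * (4 * (p n * L ^ (k + 1)) + 8 * (k + 3 : ℕ) * (n * p n ^ 2 * L ^ k)) := by
        rw [mul_pow]; ring
    _ = _ := by
        have e1 : p n * L ^ (k + 1) = p n / g n * ((n : ℝ) ^ (-(1 / 2) : ℝ) *
            Real.log n ^ (α * (k + 2))) := by
          rw [← hgL, ← mul_assoc, ← hpx]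
        have e2 : n * p n ^ 2 * L ^ k = (p n / g n) ^ 2 := by
          calc n * p n ^ 2 * L ^ k = (p n / g n) ^ 2 * (n * g n ^ 2 * L ^ k) := by
                field_simp
            _ = _ := by rw [hg2, mul_one]
        rw [e1, e2]

theorem tendsto_inv_mean {p : ℕ → ℝ}
    (hp : (fun n : ℕ => (n : ℝ) ^ (-2 : ℝ)) =o[atTop] p) :
    Tendsto (fun n : ℕ => 1 / ((n : ℝ) ^ 2 * p n / 2)) atTop (𝓝 0) := by
  have h := hp.tendsto_div_nhds_zero.const_mul 2
  rw [mul_zero] at h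
  refine h.congr fun n => ?_
  rw [Real.rpow_neg (Nat.cast_nonneg n), Real.rpow_ofNat]
  simp only [div_eq_mul_inv, mul_inv]
  ring

theorem choose_two_le {n c : ℕ} (hc : c ≤ n) : ((n - c).choose 2 : ℝ) ≤ (n : ℝ) ^ 2 / 2 := by
  rw [Nat.cast_choose_two, Nat.cast_sub hc]
  have : (c : ℝ) ≤ n := by exact_mod_cast hc
  have : (0 : ℝ) ≤ c := Nat.cast_nonneg c
  nlinarith

theorem le_choose_two {n c : ℕ} (hc : c ≤ n) :
    (n : ℝ) ^ 2 / 2 - (c + 1) * n ≤ ((n - c).choose 2 : ℝ) := by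
  rw [Nat.cast_choose_two, Nat.cast_sub hc]
  have : (0 : ℝ) ≤ n := Nat.cast_nonneg n
  have : (0 : ℝ) ≤ c := Nat.cast_nonneg c
  nlinarith

theorem triadicMeasure_le_one {r n : ℕ} (hn : 2 ≤ n) (p : unitInterval) (s : Set _) :
    triadicMeasure r n p s ≤ 1 := by
  have := isProbabilityMeasure_uniformOn_pairs hn
  have hP : IsProbabilityMeasure (triadicMeasure r n p) := by
    unfold triadicMeasure randomHypergraph randomChoices; infer_instance
  exact prob_le_one

end Triadic

open Triadic in
theorem theorem1p1 (r : ℕ) (hr : 3 ≤ r) (α : ℝ) (hα : 1 / 2 < α) (p : ℕ → unitInterval)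
    (hp_upper : (fun n : ℕ => (p n : ℝ)) =o[atTop]
      fun n : ℕ => (n : ℝ) ^ (-(1 / 2) : ℝ) * Real.log n ^ (α * (3 - (r : ℝ))))
    (hp_lower : (fun n : ℕ => (n : ℝ) ^ (-2 : ℝ)) =o[atTop] fun n : ℕ => (p n : ℝ)) :
    ∀ ε : ℝ, 0 < ε →
      Tendsto
        (fun n : ℕ => Triadic.triadicMeasure r n (p n)
          {ω | |(Triadic.addedEdges r ω.1 ω.2 : ℝ) - (n : ℝ) ^ 2 * (p n : ℝ) / 2|
            ≤ ε * ((n : ℝ) ^ 2 * (p n : ℝ) / 2)})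
        atTop (𝓝 1) := by
  intro ε hε
  have hp0 : ∀ n, (0 : ℝ) ≤ p n := fun n => (p n).2.1
  have hr0 : (0 : ℝ) < r := by exact_mod_cast (by omega : 0 < r)
  set η : ℕ → ℝ := fun n => (p n : ℝ) * (((degBound r α (p n) n + r) *
    completions r (codegBound α n) : ℕ) : ℝ)
  have hη : Tendsto η atTop (𝓝 0) :=
    tendsto_degBound_mul_completions hr (by linarith) hp0 hp_upper
  have hμ := tendsto_inv_mean hp_lower
  have hexp := tendsto_exp_sub_rpow (show 1 < 2 * α by linarith)
    (show 0 < 1 / (2 * (r : ℝ)) by positivity)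
  have hlow : Tendsto (fun n : ℕ => ENNReal.ofReal (1 - (2 * Real.exp (2 * Real.log n -
      1 / (2 * (r : ℝ)) * Real.log n ^ (2 * α)) + 16 / ε ^ 2 * (1 / ((n : ℝ) ^ 2 * p n / 2)) +
      8 * r ^ 2 / ε * (r * r * η n)))) atTop (𝓝 1) := by
    have h := (((hexp.const_mul 2).add (hμ.const_mul (16 / ε ^ 2))).add
      ((hη.const_mul ((r : ℝ) * r)).const_mul (8 * r ^ 2 / ε))).const_sub 1
    have := ENNReal.tendsto_ofReal h
    simpa using this
  refine tendsto_of_tendsto_of_tendsto_of_le_of_le' hlow tendsto_const_nhds ?_ ?_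
  swap
  · filter_upwards [eventually_ge_atTop 2] with n hn
    exact triadicMeasure_le_one hn _ _
  have hL : Tendsto (fun n : ℕ => Real.log n ^ (2 * α)) atTop atTop :=
    (tendsto_rpow_atTop (by linarith)).comp tendsto_log_natCast
  have hp_pos : ∀ᶠ n : ℕ in atTop, (0 : ℝ) < p n := by
    filter_upwards [hp_lower.bound one_pos, eventually_gt_atTop 0] with n h hn
    have h1 : (0 : ℝ) < (n : ℝ) ^ (-2 : ℝ) := Real.rpow_pos_of_pos (by exact_mod_cast hn) _
    rw [one_mul, Real.norm_of_nonneg h1.le, Real.norm_of_nonneg (hp0 n)] at h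
    linarith
  -- The thresholds give, in turn from the first one on `η`: `pT ≤ 1/2`; the exponents in `x1` and
  -- `x2`; `r² ≤ (ε/4)μ`; `r ≤ D`; and a mean within `(ε/4)μ` of `μ`.
  filter_upwards [eventually_ge_atTop 2, eventually_ge_atTop r, hp_pos,
    hη.eventually_le_const (show 0 < 1 / (2 * (r : ℝ) * r) by positivity),
    hη.eventually_le_const (show 0 < 1 / (152 * (r : ℝ)) by positivity),
    hμ.eventually_le_const (show 0 < ε / 4 / (r : ℝ) ^ 2 by positivity),
    hL.eventually_ge_atTop (r : ℝ),
    tendsto_natCast_atTop_atTop.eventually_ge_atTop (8 * (((r - 2 : ℕ) : ℝ) + 1) / ε)]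
    with n hn2 hnr hp η1 η2 hμ1 hLr hnε
  have hn' : (0 : ℝ) < n := by exact_mod_cast (by omega : 0 < n)
  have hμpos : 0 < (n : ℝ) ^ 2 * p n / 2 := by positivity
  set D := codegBound α n with hDdef
  set Δ := degBound r α (p n) n with hΔdef
  set K := completions r D
  have hDL : Real.log n ^ (2 * α) ≤ D := Nat.le_ceil _
  have hΔD : (D : ℝ) + 8 * r * n * p n ≤ Δ := by
    rw [hΔdef, degBound]
    push_cast
    linarith [Nat.le_ceil (8 * (r : ℝ) * n * p n)]
  have hηdef : η n = p n * (((Δ + r) * K : ℕ) : ℝ) := rfl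
  have hη0 : 0 ≤ η n := mul_nonneg (hp0 n) (Nat.cast_nonneg _)
  have hθ : (p n : ℝ) * ((r * r * ((Δ + r) * K) : ℕ) : ℝ) = r * r * η n := by
    rw [hηdef]; push_cast; ring
  have hDΔ : D ≤ Δ := Nat.le_add_right _ _
  have hrD : (r : ℝ) ≤ D := hLr.trans hDL
  have hDΔ' : (D : ℝ) ≤ Δ := by exact_mod_cast hDΔ
  have x1 : 2 * (p n : ℝ) * ((n + 2 * ((Δ + r) * ((Δ + r) * K)) : ℕ) : ℝ) - Δ / r ≤
      -(1 / (2 * (r : ℝ)) * Real.log n ^ (2 * α)) := by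
    have e : 2 * (p n : ℝ) * ((n + 2 * ((Δ + r) * ((Δ + r) * K)) : ℕ) : ℝ) =
        2 * p n * n + 4 * (Δ + r) * η n := by
      rw [hηdef]; push_cast; ring
    -- The summand `8rnp` of `Δ` is chosen for this inequality.
    have h1 : 2 * (p n : ℝ) * n ≤ (Δ : ℝ) / (4 * r) := by
      rw [le_div_iff₀ (by positivity)]; nlinarith [(Nat.cast_nonneg D : (0 : ℝ) ≤ D)]
    have h2 : 4 * (Δ + r) * η n ≤ (Δ : ℝ) / (4 * r) := by
      have hrΔ : (r : ℝ) ≤ Δ := hrD.trans hDΔ'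
      calc 4 * (Δ + r) * η n ≤ 4 * (Δ + Δ) * (1 / (152 * (r : ℝ))) := by gcongr
        _ ≤ 4 * (Δ + Δ) * (1 / (32 * (r : ℝ))) := by gcongr; norm_num
        _ = _ := by field_simp; ring
    have h3 : 1 / (2 * (r : ℝ)) * Real.log n ^ (2 * α) ≤ (Δ : ℝ) / (2 * r) := by
      rw [one_div, inv_mul_eq_div]; gcongr; linarith
    have h4 : (Δ : ℝ) / r = Δ / (4 * r) + Δ / (4 * r) + Δ / (2 * r) := by field_simp; ring
    linarith
  have x2 : 2 * (p n : ℝ) * ((19 * ((Δ + r) * (D + r) * K) : ℕ) : ℝ) - D / r ≤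
      -(1 / (2 * (r : ℝ)) * Real.log n ^ (2 * α)) := by
    have e : 2 * (p n : ℝ) * ((19 * ((Δ + r) * (D + r) * K) : ℕ) : ℝ) =
        38 * (D + r) * η n := by
      rw [hηdef]; push_cast; ring
    have h2 : 38 * (D + r) * η n ≤ (D : ℝ) / (2 * r) := by
      -- Here `38 = 2 * 19`, and `152 = 4 * 38` leaves half of `D / r` for the tail.
      calc 38 * (D + r) * η n ≤ 38 * (D + D) * (1 / (152 * (r : ℝ))) := by gcongr
        _ = _ := by field_simp; ring
    have h3 : 1 / (2 * (r : ℝ)) * Real.log n ^ (2 * α) ≤ (D : ℝ) / (2 * r) := by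
      rw [one_div, inv_mul_eq_div]; gcongr
    have h4 : (D : ℝ) / r = D / (2 * r) + D / (2 * r) := by field_simp; norm_num
    linarith
  have hnlog : (n : ℝ) ^ 2 = Real.exp (2 * Real.log n) := by
    rw [two_mul, Real.exp_add, Real.exp_log hn', sq]
  have hnn : (n : ℝ) ≤ (n : ℝ) ^ 2 := by
    have : (1 : ℝ) ≤ n := by exact_mod_cast (by omega : 1 ≤ n)
    nlinarith
  have hc : r - 2 ≤ n := by omega
  have hm1 : (p n : ℝ) * (n - (r - 2)).choose 2 ≤ (n : ℝ) ^ 2 * p n / 2 := by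
    have := mul_le_mul_of_nonneg_left (choose_two_le hc) (hp0 n)
    linarith
  have hm2 : (n : ℝ) ^ 2 * p n / 2 - p n * (n - (r - 2)).choose 2 ≤
      ε / 4 * ((n : ℝ) ^ 2 * p n / 2) := by
    have h1 := mul_le_mul_of_nonneg_left (le_choose_two hc) (hp0 n)
    have h2 : 8 * (((r - 2 : ℕ) : ℝ) + 1) ≤ n * ε := (div_le_iff₀ hε).1 hnε
    have h3 := mul_le_mul_of_nonneg_left h2 (mul_nonneg (hp0 n) hn'.le)
    linarith
  refine le_trans (ENNReal.ofReal_le_ofReal ?_) (triadicMeasure_ge hr hc hn2 (p n) hDΔ ?_ hε hμpos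
    ?_ ?_ hm1)
  · rw [hθ]
    have y1 : n * Real.exp (2 * (p n : ℝ) * ((n + 2 * ((Δ + r) * ((Δ + r) * K)) : ℕ) : ℝ) - Δ / r) ≤
        Real.exp (2 * Real.log n - 1 / (2 * (r : ℝ)) * Real.log n ^ (2 * α)) := by
      rw [sub_eq_add_neg (2 * Real.log n), Real.exp_add, ← hnlog]
      gcongr
    have y2 : (n : ℝ) ^ 2 * Real.exp (2 * (p n : ℝ) * ((19 * ((Δ + r) * (D + r) * K) : ℕ) : ℝ)
        - D / r) ≤ Real.exp (2 * Real.log n - 1 / (2 * (r : ℝ)) * Real.log n ^ (2 * α)) := by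
      rw [sub_eq_add_neg (2 * Real.log n), Real.exp_add, ← hnlog]
      gcongr
    linarith
  · rw [hθ]
    rw [le_div_iff₀ (by positivity)] at η1
    linarith
  · rw [div_le_div_iff₀ hμpos (by positivity)] at hμ1
    linarith
  · rw [abs_le]
    constructor
    · linarith
    · have : 0 ≤ ε / 4 * ((n : ℝ) ^ 2 * p n / 2) := by positivity
      linarith
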